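/- **Model.** There are finitely many ad networks $i$, with rates $\rho_i\in[0,1]$. Impressions arrive one after the other. At each arrival the impression $j$ is drawn from a fixed distribution $\mathcal D$ on a finite set, and, given $j$, the vector $v$ of the bids of all networks is drawn from a fixed distribution on a finite set; the arrivals are independent. A policy decides at each arrival, possibly with randomization, which set $S$ of networks to call out and with which additional parameters $a$ (e.g. prices, from a finite set). It may use the arrival times, the impressions so far, its own coins, and the bids revealed by its earlier call-outs, but not the current bids. The objective value of an impression is additive given the allocation and the realizations, and the exchange uses the best allocation: it equals $\max_x\sum_{i\in S}w_i(j,a,x,v)$, where $x$ ranges over a finite nonempty set of allocations and $w_i\ge 0$. The performance of a policy is its expected objective value per arriving impression in the long run (the $\liminf$ as $T\to\infty$ of the average over the first $T$ impressions). A policy is $\alpha$-approximate in a model if it is admissible in that model and its performance is at least $\alpha$ times that of every admissible policy of that model. *Time-average uniform-arrival model:* one impression arrives per time unit, and a policy is admissible if almost surely, for each $i$, the long-run fraction ($\limsup$) of impressions on which $i$ is called out is at most $\rho_i$. *Token bucket model:* network $i$ has a bucket of size $\sigma_i$, full at the beginning; tokens are generated at rate $\rho_i$ per unit of time and are lost when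 the bucket is full; calling out $i$ uses one token, and a policy is admissible if almost surely it calls out a network only when there is at least one token in its bucket. Impressions arrive in this model either one per time unit (uniform arrivals) or as a unit rate Poisson process (Poisson arrivals). **Conversion.** A *memoryless rule* draws, at each arrival, the decision from a distribution that depends only on the current impression, with fresh randomness. A memoryless rule $s$ is a *memoryless version* of a policy $A$ if the probabilities, under $s$, of the pairs (impression, decision) form a limit point, as $T\to\infty$, of the expected frequencies of these pairs in the first $T$ arrivals under $A$. The *converted policy* $s'$ behaves exactly as $s$, except that no call-out is made to a network whose bucket holds less than one token. **Theorem.** Let $A$ be an $\alpha$-approximate policy in the time-average uniform-arrival model, and let $\sigma>1$ and $\sigma_i>\sigma$ for all $i$. Then $A$ has a memoryless version, and every memoryless policy is a memoryless version of itself. Moreover, for every memoryless version $s$ of $A$, the converted policy $s'$ is a $\left(\alpha-\frac{1}{\sigma-1}\right)$-approximate policy in the token bucket model, both under uniform and under Poisson arrivals. In both cases also $R_i'\ge\left(1-\frac{1}{\sigma_i-1}\right)R_i$ for each network $i$, where, for an arbitrary choice of an allocation for each impression, decision of $s$ and vector of realized bids, $R_i$ and $R_i'$ are the long-run values per arriving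 impression obtained from network $i$ under this allocation by $s$ and by $s'$. -/

import Mathlib

open MeasureTheory ProbabilityTheory Filter Topology

noncomputable section

namespace CallOut

/-- The two arrival models: one impression per unit of time, or a unit rate Poisson process
(independent exponential inter-arrival times of mean one). -/
inductive Arrival
  | uniform
  | poisson

/-- The law of the time between two consecutive impressions. -/
def Arrival.gapLaw : Arrival → Measure ℝ
  | .uniform => Measure.dirac 1
  | .poisson => expMeasure 1

instance (k : Arrival) : IsProbabilityMeasure k.gapLaw := by
  cases k
  · exact Measure.dirac.isProbabilityMeasure
  · exact isProbabilityMeasure_expMeasure one_pos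

/-- A call-out decision for one impression: the set of networks that are called out, together with
the further parameters (reserve price, posted prices) that are announced with the call-out. -/
abbrev Decision (N Act : Type*) := Finset N × Act

/-- What nature and the coins of the policy produce at one arrival: the time elapsed since the
previous arrival, the impression and the bids of all networks, a uniform random seed. -/
abbrev Event (N J B : Type*) := ℝ × (J × (N → B)) × unitInterval

/-- A complete infinite history. -/
abbrev Path (N J B : Type*) := ℕ → Event N J B

section Coordinates

variable {N J B : Type*}

/-- Time elapsed between the arrivals `t - 1` and `t` (unused for `t = 0`). -/
def gap (t : ℕ) (ω : Path N J B) : ℝ := (ω t).1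

/-- The impression that arrives at step `t`. -/
def imp (t : ℕ) (ω : Path N J B) : J := (ω t).2.1.1

/-- The bid of every network for the impression of step `t`. -/
def bid (t : ℕ) (ω : Path N J B) : N → B := (ω t).2.1.2

/-- The random seed of step `t`. -/
def seed (t : ℕ) (ω : Path N J B) : unitInterval := (ω t).2.2

end Coordinates

/-- A call-out policy: the decision taken at each arrival. -/
abbrev Policy (N J B Act : Type*) := ℕ → Path N J B → Decision N Act

/-- A memoryless randomized decision rule: the decision depends on the current impression
and on a fresh uniform random seed. -/
abbrev Rule (N J Act : Type*) := J → unitInterval → Decision N Act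

section Information

variable {N J B Act : Type*} [DecidableEq N] [MeasurableSpace J]

/-- The bids revealed by the decision of step `t`: those of the networks called out. -/
def observed (A : Policy N J B Act) (t : ℕ) (ω : Path N J B) : N → Option B :=
  fun i => if i ∈ (A t ω).1 then some (bid t ω i) else none

/-- What the policy knows when it decides at step `t`: times, impressions and seeds up to
and including step `t`, and the bids revealed by its own call-outs before step `t`. -/
abbrev info (A : Policy N J B Act) (t : ℕ) : MeasurableSpace (Path N J B) :=
  (⨆ r : ℕ, ⨆ _ : r ≤ t, MeasurableSpace.comap
    (fun ω : Path N J B => (gap r ω, imp r ω, seed r ω)) inferInstance) ⊔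
  (⨆ r : ℕ, ⨆ _ : r < t, MeasurableSpace.comap (observed A r) ⊤)

/-- The policy decides on the basis of what it knows; in particular it has no knowledge of the
bids for the current impression. -/
def NonAnticipating (A : Policy N J B Act) : Prop :=
  ∀ t, @Measurable _ _ (info A t) ⊤ (A t)

end Information

/-- The data of a call-out problem, apart from bucket sizes. `N` is the set of networks, `J` of
impressions, `B` of bid values, `Act` of additional decision parameters (prices), and `Alloc` of
allocations (for instance, of slots to networks). -/
structure Exchange (N J B Act Alloc : Type*) where
  /-- distribution of the arriving impression -/
  D : PMF J
  /-- conditional law of the vector of bids, given the impression -/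
  bidLaw : J → PMF (N → B)
  /-- `weight j a x v i` is the value obtained from network `i`, if called out, for impression `j`
  when the parameters are `a`, the realized bids are `v` and the allocation is `x`. -/
  weight : J → Act → Alloc → (N → B) → N → ℝ
  weight_nonneg : ∀ j a x v i, 0 ≤ weight j a x v i
  /-- permitted call-out rate (token generation rate) of each network -/
  rate : N → ℝ
  rate_nonneg : ∀ i, 0 ≤ rate i
  rate_le_one : ∀ i, rate i ≤ 1

namespace Exchange

variable {N J B Act Alloc : Type*} [Fintype N] [DecidableEq N] [Fintype J] [MeasurableSpace J]
  [Fintype B] [MeasurableSpace B] [Fintype Act] [Fintype Alloc] [Nonempty Alloc]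

/-- The objective for one impression. Given the allocation and the realized bids it is the sum of
the contributions of the networks called out; the exchange uses the best allocation. -/
def value (E : Exchange N J B Act Alloc) (j : J) (d : Decision N Act) (v : N → B) : ℝ :=
  Finset.univ.sup' Finset.univ_nonempty (fun x : Alloc => ∑ i ∈ d.1, E.weight j d.2 x v i)

/-- Joint law of the impression and the bids at one arrival. -/
def marketLaw (E : Exchange N J B Act Alloc) : PMF (J × (N → B)) :=
  E.D.bind fun j => (E.bidLaw j).map fun v => (j, v)

/-- The law of the history: the arrivals are independent and identically distributed. -/
def prob [MeasurableSingletonClass J] [MeasurableSingletonClass B]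
    (E : Exchange N J B Act Alloc) (k : Arrival) : Measure (Path N J B) :=
  haveI : IsProbabilityMeasure E.marketLaw.toMeasure := PMF.toMeasure.isProbabilityMeasure _
  Measure.infinitePi fun _ : ℕ =>
    k.gapLaw.prod (E.marketLaw.toMeasure.prod (volume : Measure unitInterval))

variable [MeasurableSingletonClass J] [MeasurableSingletonClass B]

/-- Long-run average of the expectations of a sequence of rewards, per arriving impression. -/
def longRun (E : Exchange N J B Act Alloc) (k : Arrival) (f : ℕ → Path N J B → ℝ) : ℝ :=
  liminf (fun T : ℕ => (∑ t ∈ Finset.range T, ∫ ω, f t ω ∂(E.prob k)) / T) atTop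

/-- The performance of a policy: expected objective value per arriving impression. -/
def perf (E : Exchange N J B Act Alloc) (k : Arrival) (A : Policy N J B Act) : ℝ :=
  E.longRun k fun t ω => E.value (imp t ω) (A t ω) (bid t ω)

/-- Admissible policies of the time average model: almost surely, in the long run, network `i` is
called out on at most a fraction `rate i` of the arriving impressions. -/
def TimeAverageAdmissible (E : Exchange N J B Act Alloc) (k : Arrival)
    (A : Policy N J B Act) : Prop :=
  NonAnticipating A ∧ ∀ᵐ ω ∂(E.prob k), ∀ i, ∀ ε > 0, ∀ᶠ T : ℕ in atTop,
    (((Finset.range T).filter fun t => i ∈ (A t ω).1).card : ℝ) ≤ (E.rate i + ε) * T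

/-- The number of tokens in the bucket of network `i` at arrival `t`, under the policy `A`. The
bucket is full at the beginning, each call-out uses a token, tokens are generated at rate `rate i`
per unit of time, and tokens in excess of the bucket size are lost. -/
def tokens (E : Exchange N J B Act Alloc) (size : N → ℝ) (A : Policy N J B Act)
    (ω : Path N J B) (i : N) : ℕ → ℝ
  | 0 => size i
  | t + 1 => min (size i)
      (tokens E size A ω i t - (if i ∈ (A t ω).1 then 1 else 0) + E.rate i * gap (t + 1) ω)

/-- Admissible policies of the token bucket model: a network is called out only when
there is at least one token in its bucket. -/
def TokenAdmissible (E : Exchange N J B Act Alloc) (size : N → ℝ) (k : Arrival)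
    (A : Policy N J B Act) : Prop :=
  NonAnticipating A ∧ ∀ᵐ ω ∂(E.prob k), ∀ t, ∀ i ∈ (A t ω).1, 1 ≤ E.tokens size A ω i t

/-- `A` is admissible and achieves at least `α` times the performance of every admissible policy. -/
def IsApproximate (E : Exchange N J B Act Alloc) (k : Arrival)
    (Admissible : Policy N J B Act → Prop) (α : ℝ) (A : Policy N J B Act) : Prop :=
  Admissible A ∧ ∀ A' : Policy N J B Act, Admissible A' → α * E.perf k A' ≤ E.perf k A

/-- The memoryless policy that applies the rule `s` at each arrival. -/
def applyRule (s : Rule N J Act) : Policy N J B Act := fun t ω => s (imp t ω) (seed t ω)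

/-- Frequency with which, in the first `T` arrivals (under uniform arrivals), the impression is `j`
and `A` takes the decision `d`, in expectation. -/
def frequency (E : Exchange N J B Act Alloc) (A : Policy N J B Act) (T : ℕ)
    (p : J × Decision N Act) : ℝ :=
  (∑ t ∈ Finset.range T,
    (E.prob .uniform).real {ω | imp t ω = p.1 ∧ A t ω = p.2}) / T

/-- The probability that the impression is `j` and the rule `s` takes the decision `d`. -/
def ruleFrequency (E : Exchange N J B Act Alloc) (s : Rule N J Act)
    (p : J × Decision N Act) : ℝ :=
  (E.D p.1).toReal * (volume : Measure unitInterval).real {u | s p.1 u = p.2}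

/-- `s` is a memoryless version of `A`: it takes each decision on each impression with a long-run
frequency of `A` (a limit point of the frequencies of `A`). -/
def IsMemorylessVersion (E : Exchange N J B Act Alloc) (A : Policy N J B Act)
    (s : Rule N J Act) : Prop :=
  (∀ j, @Measurable _ _ _ ⊤ (s j)) ∧
    MapClusterPt (E.ruleFrequency s) atTop (fun T : ℕ => E.frequency A T)

/-- Contents of the buckets when the rule `s` is applied, except that no call-out is made to a
network whose bucket holds less than one token. -/
def bucket (E : Exchange N J B Act Alloc) (size : N → ℝ) (s : Rule N J Act)
    (ω : Path N J B) (i : N) : ℕ → ℝ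
  | 0 => size i
  | t + 1 => min (size i)
      (bucket E size s ω i t
        - (if i ∈ (s (imp t ω) (seed t ω)).1 ∧ 1 ≤ bucket E size s ω i t then 1 else 0)
        + E.rate i * gap (t + 1) ω)

/-- The converted policy: it behaves exactly as the rule `s`, except that no call-out is made to a
network whose token bucket is empty. -/
def throttle (E : Exchange N J B Act Alloc) (size : N → ℝ) (s : Rule N J Act) :
    Policy N J B Act := fun t ω =>
  ((s (imp t ω) (seed t ω)).1.filter fun i => 1 ≤ E.bucket size s ω i t,
    (s (imp t ω) (seed t ω)).2)

/-- The value per arriving impression received from network `i` by a policy `A` that carries out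
(some of) the call-outs of the rule `s`, where `alloc` is the allocation made for the decisions of
`s` and the realized bids. -/
def networkValue (E : Exchange N J B Act Alloc) (k : Arrival) (s : Rule N J Act)
    (alloc : J → Decision N Act → (N → B) → Alloc) (i : N) (A : Policy N J B Act) : ℝ :=
  E.longRun k fun t ω =>
    if i ∈ (A t ω).1 then
      E.weight (imp t ω) (s (imp t ω) (seed t ω)).2
        (alloc (imp t ω) (s (imp t ω) (seed t ω)) (bid t ω)) (bid t ω) i
    else 0

end Exchange

end CallOut

end

noncomputable section

set_option linter.unusedSectionVars false

namespace CallOut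


/-! Since a policy cannot see the current bids, the expected value of its first `T` arrivals is a
linear function of its expected frequencies of (impression, decision) pairs (`integral_value`).
These frequencies lie in a compact cube, so they have limit points, and a limit point is realized by
a rule because a uniform seed can simulate every law on the finite set of decisions
(`exists_rule_mapClusterPt`). Call rates pass to the limit point, and its value is at least the
`liminf` that defines the performance (`perf_le_of_mapClusterPt`). This gives the memoryless version
`s` of `A`. It also shows that every token-admissible policy, under either arrival model, is matched
by a time-average admissible memoryless policy (`TokenAdmissible.exists_rule`), so the optimum of
the time-average model bounds that of the token model.

It remains to bound the loss caused by throttling `s`. Let `p ≤ rate i` be the probability that `s`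
calls out network `i`, and let `L` be the deficit of its bucket. The potential is `L ^ 2`. A bucket
without a token has deficit above `size i - 1`, and during such a step the deficit is reduced by
refill without being increased by a call; on average this lowers the potential by order `p * (size i
- 1)`. All other contributions to the drift are at most `2 * p`. The potential starts at zero and
stays nonnegative, so the average probability of an empty bucket is at most `1 / (size i - 1)`
(`integral_deficit_sq_succ_le`, `sum_readyProb_ge`). The arrival process enters only through
independent nonnegative gaps of mean one and second moment at most two, which holds for both models.

The bucket content is determined before the current impression, bids and seed are drawn, so
throttling scales the expected reward from `i` at each arrival by exactly the probability that its
bucket is ready. Additivity over networks then gives the bound for the whole objective. -/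

theorem indepFun_prodMk_left {Ω α β γ : Type*} [MeasurableSpace Ω] [MeasurableSpace α]
    [MeasurableSpace β] [MeasurableSpace γ] {μ : Measure Ω} [IsProbabilityMeasure μ]
    {X : Ω → α} {Y : Ω → β} {Z : Ω → γ} (hX : Measurable X) (hY : Measurable Y)
    (hZ : Measurable Z) (h : IndepFun X (fun ω => (Y ω, Z ω)) μ) (hYZ : IndepFun Y Z μ) :
    IndepFun (fun ω => (X ω, Y ω)) Z μ := by
  have hXY : IndepFun X Y μ := h.comp measurable_id measurable_fst
  have : IsProbabilityMeasure (μ.map X) := Measure.isProbabilityMeasure_map hX.aemeasurable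
  have : IsProbabilityMeasure (μ.map Y) := Measure.isProbabilityMeasure_map hY.aemeasurable
  have : IsProbabilityMeasure (μ.map Z) := Measure.isProbabilityMeasure_map hZ.aemeasurable
  rw [indepFun_iff_map_prod_eq_prod_map_map (by fun_prop) (by fun_prop)] at h hYZ hXY ⊢
  rw [hXY, ← ((measurePreserving_prodAssoc (μ.map X) (μ.map Y) (μ.map Z)).symm).map_eq, ← hYZ, ← h,
    Measure.map_map (by fun_prop) (by fun_prop)]
  rfl

/-! ### Information of a policy and independence of the current bids. -/

section Coordinates

variable {N J B Act : Type*}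

/-- The events of the arrivals before step `t`. -/
def past (t : ℕ) (ω : Path N J B) : Finset.range t → Event N J B := fun r => ω r

/-- The impression and the bids of step `t`. -/
def market (t : ℕ) (ω : Path N J B) : J × (N → B) := (ω t).2.1

/-- All that happens before the impression of step `t` is seen, and the seed of step `t`. -/
def before (t : ℕ) (ω : Path N J B) : (Finset.range t → Event N J B) × (ℝ × unitInterval) :=
  (past t ω, (gap t ω, seed t ω))

variable [MeasurableSpace J] [MeasurableSpace B]

@[fun_prop] theorem measurable_past (t : ℕ) : Measurable (past (N := N) (J := J) (B := B) t) := by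
  unfold past; fun_prop
@[fun_prop] theorem measurable_market (t : ℕ) :
    Measurable (market (N := N) (J := J) (B := B) t) := by
  unfold market; fun_prop
@[fun_prop] theorem measurable_gap (t : ℕ) : Measurable (gap (N := N) (J := J) (B := B) t) := by
  unfold gap; fun_prop
@[fun_prop] theorem measurable_imp (t : ℕ) : Measurable (imp (N := N) (J := J) (B := B) t) := by
  unfold imp; fun_prop
@[fun_prop] theorem measurable_bid (t : ℕ) : Measurable (bid (N := N) (J := J) (B := B) t) := by
  unfold bid; fun_prop
@[fun_prop] theorem measurable_seed (t : ℕ) : Measurable (seed (N := N) (J := J) (B := B) t) := by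
  unfold seed; fun_prop
@[fun_prop] theorem measurable_before (t : ℕ) :
    Measurable (before (N := N) (J := J) (B := B) t) := by
  unfold before; fun_prop

variable [Finite N] [Finite J] [MeasurableSingletonClass J] [Finite B] [MeasurableSingletonClass B]
  [DecidableEq N] [Finite Act]

/-- Revealed bids belong to earlier arrivals, and which of them are revealed depends on earlier
decisions. All information is therefore a function of the complete past and of the current gap, seed
and impression. -/
theorem info_le_comap {A : Policy N J B Act} (hA : NonAnticipating A) (t : ℕ) :
    info A t ≤ MeasurableSpace.comap (fun ω => (before t ω, imp t ω)) inferInstance := by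
  let : MeasurableSpace (Decision N Act) := ⊤
  have : DiscreteMeasurableSpace (Decision N Act) := ⟨fun _ => trivial⟩
  -- The observation at `r < t` involves the decision `A r`, whose measurability comes from the
  -- claim for `r`.
  induction t using Nat.strong_induction_on with
  | _ t ih =>
  set m : MeasurableSpace (Path N J B) :=
    MeasurableSpace.comap (fun ω => (before t ω, imp t ω)) inferInstance with hm
  have hk : Measurable[m] (fun ω : Path N J B => (before t ω, imp t ω)) := comap_measurable _
  have hpast : ∀ r < t, Measurable[m] (fun ω : Path N J B => ω r) := by
    intro r hr
    have : Measurable (fun x : ((Finset.range t → Event N J B) × (ℝ × unitInterval)) × J =>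
      x.1.1 ⟨r, Finset.mem_range.2 hr⟩) := by fun_prop
    exact this.comp hk
  refine sup_le (iSup₂_le fun r hr => ?_) (iSup₂_le fun r hr => ?_)
  · refine Measurable.comap_le ?_
    rcases hr.lt_or_eq with hr | rfl
    · have : Measurable (fun x : Event N J B => (x.1, x.2.1.1, x.2.2)) := by fun_prop
      exact this.comp (hpast r hr)
    · have : Measurable (fun x : ((Finset.range r → Event N J B) × (ℝ × unitInterval)) × J =>
        (x.1.2.1, x.2, x.1.2.2)) := by fun_prop
      exact this.comp hk
  · refine Measurable.comap_le ?_
    have h1 : MeasurableSpace.comap (fun ω => (before r ω, imp r ω)) inferInstance ≤ m := by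
      refine Measurable.comap_le ?_
      have h2 : Measurable[m] (past (N := N) (J := J) (B := B) r) :=
        measurable_pi_lambda _ fun q => hpast q ((Finset.mem_range.1 q.2).trans hr)
      have h3 : Measurable (fun x : Event N J B => (x.1, x.2.2)) := by fun_prop
      have h4 : Measurable (fun x : Event N J B => x.2.1.1) := by fun_prop
      exact (h2.prodMk (h3.comp (hpast r hr))).prodMk (h4.comp (hpast r hr))
    have h5 : Measurable[m] (A r) := (hA r).mono ((ih r hr).trans h1) le_rfl
    have h6 : Measurable[m] (bid (N := N) (J := J) (B := B) r) := by
      have : Measurable (fun x : Event N J B => x.2.1.2) := by fun_prop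
      exact this.comp (hpast r hr)
    have h7 : @Measurable _ _ _ ⊤ (fun x : Decision N Act × (N → B) =>
        (fun i => if i ∈ x.1.1 then some (x.2 i) else none : N → Option B)) := by
      let : MeasurableSpace (N → Option B) := ⊤
      exact Measurable.of_discrete
    exact h7.comp (h5.prodMk h6)

theorem NonAnticipating.measurable_comap {A : Policy N J B Act} (hA : NonAnticipating A) (t : ℕ) :
    @Measurable _ _ (MeasurableSpace.comap (fun ω => (before t ω, imp t ω)) inferInstance) ⊤ (A t) :=
  (hA t).mono (info_le_comap hA t) le_rfl

theorem NonAnticipating.measurable {A : Policy N J B Act} (hA : NonAnticipating A) (t : ℕ) :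
    @Measurable _ _ _ ⊤ (A t) :=
  (hA.measurable_comap t).mono (Measurable.comap_le (by fun_prop)) le_rfl

end Coordinates

namespace Exchange

variable {N J B Act Alloc : Type*} [Fintype N] [DecidableEq N]
    [Fintype J] [MeasurableSpace J] [MeasurableSingletonClass J]
    [Fintype B] [MeasurableSpace B] [MeasurableSingletonClass B]
    [Fintype Act] [Fintype Alloc] [Nonempty Alloc]
    (E : Exchange N J B Act Alloc) (k : Arrival)

instance : IsProbabilityMeasure E.marketLaw.toMeasure := PMF.toMeasure.isProbabilityMeasure _

instance : IsProbabilityMeasure (E.prob k) := by unfold prob; infer_instance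

theorem map_eval (t : ℕ) : (E.prob k).map (fun ω => ω t) =
    k.gapLaw.prod (E.marketLaw.toMeasure.prod (volume : Measure unitInterval)) := by
  unfold prob; exact Measure.infinitePi_map_eval _ t

theorem map_gap (t : ℕ) : (E.prob k).map (gap t) = k.gapLaw := by
  rw [show (gap t : Path N J B → ℝ) = Prod.fst ∘ (fun ω => ω t) from rfl,
    ← Measure.map_map measurable_fst (by fun_prop), map_eval]
  simp

theorem map_snd (t : ℕ) : (E.prob k).map (fun ω => (market t ω, seed t ω)) =
    E.marketLaw.toMeasure.prod (volume : Measure unitInterval) := by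
  rw [show (fun ω : Path N J B => (market t ω, seed t ω)) = Prod.snd ∘ (fun ω => ω t) from rfl,
    ← Measure.map_map measurable_snd (by fun_prop), map_eval]
  simp

theorem map_market (t : ℕ) : (E.prob k).map (market t) = E.marketLaw.toMeasure := by
  rw [show (market t : Path N J B → _) = Prod.fst ∘ (fun ω => (market t ω, seed t ω)) from rfl,
    ← Measure.map_map measurable_fst (by fun_prop), map_snd]
  simp

theorem map_seed (t : ℕ) : (E.prob k).map (seed t) = volume := by
  rw [show (seed t : Path N J B → _) = Prod.snd ∘ (fun ω => (market t ω, seed t ω)) from rfl,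
    ← Measure.map_map measurable_snd (by fun_prop), map_snd]
  simp

theorem iIndepFun_eval : iIndepFun (fun (t : ℕ) (ω : Path N J B) => ω t) (E.prob k) := by
  unfold prob
  exact iIndepFun_infinitePi (X := fun _ => id) (fun _ => measurable_id)

theorem indepFun_past (t : ℕ) : IndepFun (past t) (fun ω => ω t) (E.prob k) := by
  have := (E.iIndepFun_eval k).indepFun_finset (Finset.range t) {t} (by simp)
    (fun _ => by fun_prop)
  have h : Measurable (fun x : ({t} : Finset ℕ) → Event N J B =>
      x ⟨t, Finset.mem_singleton_self t⟩) := measurable_pi_apply _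
  exact this.comp (φ := id) measurable_id h

theorem indepFun_gap (t : ℕ) :
    IndepFun (gap t) (fun ω => (market t ω, seed t ω)) (E.prob k) := by
  rw [indepFun_iff_map_prod_eq_prod_map_map (by fun_prop) (by fun_prop), map_gap, map_snd,
    ← E.map_eval k t]
  rfl

theorem indepFun_seed_market (t : ℕ) : IndepFun (market t) (seed t) (E.prob k) := by
  rw [indepFun_iff_map_prod_eq_prod_map_map (by fun_prop) (by fun_prop), map_seed, map_market,
    ← E.map_snd k t]

theorem indepFun_before_market (t : ℕ) : IndepFun (before t) (market t) (E.prob k) := by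
  refine indepFun_prodMk_left (by fun_prop) (by fun_prop) (by fun_prop) ?_ ?_
  · exact (E.indepFun_past k t).comp (φ := id) (ψ := fun x => ((x.1, x.2.2), x.2.1))
      measurable_id (by fun_prop)
  · refine indepFun_prodMk_left (by fun_prop) (by fun_prop) (by fun_prop) ?_
      (E.indepFun_seed_market k t).symm
    exact (E.indepFun_gap k t).comp measurable_id measurable_swap

theorem indepFun_past_gap (t : ℕ) : IndepFun (fun ω => (past t ω, gap t ω))
    (fun ω => (market t ω, seed t ω)) (E.prob k) :=
  indepFun_prodMk_left (by fun_prop) (by fun_prop) (by fun_prop) (E.indepFun_past k t)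
    (E.indepFun_gap k t)

theorem marketLaw_apply (j : J) (v : N → B) : E.marketLaw (j, v) = E.D j * E.bidLaw j v := by
  classical
  unfold marketLaw
  rw [PMF.bind_apply, tsum_eq_single j]
  · congr 1
    rw [PMF.map_apply, tsum_eq_single v]
    · simp
    · intro w hw; simp [hw.symm]
  · intro j' hj
    rw [PMF.map_apply]
    simp [hj.symm]

theorem prob_market (t : ℕ) (j : J) (v : N → B) :
    (E.prob k).real {ω | imp t ω = j ∧ bid t ω = v} =
      (E.D j).toReal * (E.bidLaw j v).toReal := by
  have : {ω : Path N J B | imp t ω = j ∧ bid t ω = v} = market t ⁻¹' {(j, v)} := by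
    ext ω; simp [imp, bid, market, Prod.ext_iff]
  rw [this, measureReal_def, ← Measure.map_apply (by fun_prop) (MeasurableSet.singleton _), map_market,
    PMF.toMeasure_apply_singleton _ _ (MeasurableSet.singleton _), marketLaw_apply, ENNReal.toReal_mul]

theorem map_imp (t : ℕ) : (E.prob k).map (imp t) = E.D.toMeasure := by
  rw [show (imp t : Path N J B → _) = Prod.fst ∘ market t from rfl,
    ← Measure.map_map measurable_fst (by fun_prop), map_market,
    PMF.toMeasure_map _ _ measurable_fst]
  congr 1
  unfold marketLaw
  rw [PMF.map_bind]
  conv_rhs => rw [← PMF.bind_pure E.D]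
  congr 1
  funext j
  rw [PMF.map_comp]
  exact PMF.map_const _ _

theorem prob_imp (t : ℕ) (j : J) :
    (E.prob k).real (imp t ⁻¹' {j}) = (E.D j).toReal := by
  rw [measureReal_def, ← Measure.map_apply (by fun_prop) (MeasurableSet.singleton _), map_imp,
    PMF.toMeasure_apply_singleton _ _ (MeasurableSet.singleton _)]

variable {E k}

/-- Once the impression is fixed, the decision is a function of `before t`, which is independent of
the current market. Decision and bids are thus conditionally independent given the impression. -/
theorem prob_decision_bid {A : Policy N J B Act} (hA : NonAnticipating A) (t : ℕ) (j : J)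
    (d : Decision N Act) (v : N → B) :
    (E.prob k).real {ω | (imp t ω = j ∧ A t ω = d) ∧ bid t ω = v} =
      (E.prob k).real {ω | imp t ω = j ∧ A t ω = d} * (E.bidLaw j v).toReal := by
  obtain ⟨S, hS, hSA⟩ := hA.measurable_comap t (show @MeasurableSet _ ⊤ {d} from trivial)
  -- Slicing at the fixed impression `j` leaves an event of `before t` alone, to which independence
  -- applies.
  have hS' : MeasurableSet {x | (x, j) ∈ S} := measurable_prodMk_right hS
  have hmem : ∀ ω, A t ω = d ↔ (before t ω, imp t ω) ∈ S := fun ω => by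
    have := Set.ext_iff.1 hSA ω
    exact this.symm
  have h1 : {ω : Path N J B | (imp t ω = j ∧ A t ω = d) ∧ bid t ω = v} =
      before t ⁻¹' {x | (x, j) ∈ S} ∩ market t ⁻¹' {(j, v)} := by
    ext ω
    simp only [Set.mem_ofPred_eq, Set.mem_inter_iff, Set.mem_preimage, Set.mem_singleton_iff, hmem,
      market, Prod.ext_iff]
    constructor
    · rintro ⟨⟨rfl, h⟩, h'⟩; exact ⟨h, rfl, h'⟩
    · rintro ⟨h, h', h''⟩
      have : imp t ω = j := h'
      exact ⟨⟨this, by rw [this]; exact h⟩, h''⟩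
  have h2 : {ω : Path N J B | imp t ω = j ∧ A t ω = d} =
      before t ⁻¹' {x | (x, j) ∈ S} ∩ imp t ⁻¹' {j} := by
    ext ω
    simp only [Set.mem_ofPred_eq, Set.mem_inter_iff, Set.mem_preimage, Set.mem_singleton_iff, hmem]
    constructor
    · rintro ⟨rfl, h⟩; exact ⟨h, rfl⟩
    · rintro ⟨h, h'⟩
      exact ⟨h', by rw [h']; exact h⟩
  have hind := E.indepFun_before_market k t
  have hind2 : IndepFun (before t) (imp t) (E.prob k) := hind.comp measurable_id measurable_fst
  have h3 := E.prob_market k t j v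
  have h4 : {ω : Path N J B | imp t ω = j ∧ bid t ω = v} = market t ⁻¹' {(j, v)} := by
    ext ω; simp [imp, bid, market, Prod.ext_iff]
  rw [h4] at h3
  have e1 := hind.measure_inter_preimage_eq_mul _ _ hS' (MeasurableSet.singleton (j, v))
  have e2 := hind2.measure_inter_preimage_eq_mul _ _ hS' (MeasurableSet.singleton j)
  rw [h1, h2, measureReal_def, measureReal_def, e1, e2, ENNReal.toReal_mul, ENNReal.toReal_mul,
    ← measureReal_def, ← measureReal_def, ← measureReal_def, h3, prob_imp]
  ring

/-- Expected objective value of a decision on an impression. -/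
def meanValue (E : Exchange N J B Act Alloc) (p : J × Decision N Act) : ℝ :=
  ∑ v, (E.bidLaw p.1 v).toReal * E.value p.1 p.2 v

theorem integral_value {A : Policy N J B Act} (hA : NonAnticipating A) (t : ℕ) :
    ∫ ω, E.value (imp t ω) (A t ω) (bid t ω) ∂(E.prob k) =
      ∑ p : J × Decision N Act,
        (E.prob k).real {ω | imp t ω = p.1 ∧ A t ω = p.2} * E.meanValue p := by
  let : MeasurableSpace (Decision N Act) := ⊤
  have : DiscreteMeasurableSpace (Decision N Act) := ⟨fun _ => trivial⟩
  have hm : Measurable (fun ω => (((imp t ω, A t ω), bid t ω) : (J × Decision N Act) × (N → B))) :=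
    ((measurable_imp t).prodMk (hA.measurable t)).prodMk (measurable_bid t)
  have h1 := integral_map (μ := E.prob k) hm.aemeasurable
    (f := fun x : (J × Decision N Act) × (N → B) => E.value x.1.1 x.1.2 x.2)
    (Measurable.of_discrete.aestronglyMeasurable)
  have : IsFiniteMeasure ((E.prob k).map
    (fun ω => (((imp t ω, A t ω), bid t ω) : (J × Decision N Act) × (N → B)))) := inferInstance
  rw [← h1, integral_fintype (Integrable.of_finite), Fintype.sum_prod_type]
  refine Finset.sum_congr rfl fun p _ => ?_
  rw [meanValue, Finset.mul_sum]
  refine Finset.sum_congr rfl fun v _ => ?_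
  rw [map_measureReal_apply hm (MeasurableSet.singleton _), ← mul_assoc, ← prob_decision_bid hA,
    smul_eq_mul]
  congr 2
  ext ω
  simp [Prod.ext_iff]

end Exchange


/-! ### Moments of the inter-arrival times. -/

theorem measurable_gammaPDF (a r : ℝ) : Measurable (gammaPDF a r) :=
  (measurable_gammaPDFReal a r).ennreal_ofReal

theorem gammaPDF_one_one_smul_pow (n : ℕ) :
    (fun x : ℝ => (gammaPDF 1 1 x).toReal • x ^ n) =
      (Set.Ici 0).indicator (fun x => Real.exp (-x) * x ^ ((n + 1 : ℝ) - 1)) := by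
  funext x
  by_cases hx : 0 ≤ x
  · rw [Set.indicator_of_mem (Set.mem_Ici.2 hx), gammaPDF, ENNReal.toReal_ofReal
      (gammaPDFReal_nonneg one_pos one_pos x), gammaPDFReal, if_pos hx]
    simp
  · rw [Set.indicator_of_notMem (by simpa using hx), gammaPDF_of_neg (not_le.1 hx)]
    simp

theorem integrable_pow_expMeasure_one (n : ℕ) : Integrable (fun x : ℝ => x ^ n) (expMeasure 1) := by
  rw [expMeasure, gammaMeasure, integrable_withDensity_iff_integrable_smul'
    (measurable_gammaPDF 1 1) (by simp [gammaPDF]),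
    gammaPDF_one_one_smul_pow, integrable_indicator_iff measurableSet_Ici, integrableOn_Ici_iff_integrableOn_Ioi]
  exact Real.GammaIntegral_convergent (by positivity)

theorem integral_pow_expMeasure_one (n : ℕ) :
    ∫ x : ℝ, x ^ n ∂(expMeasure 1) = n.factorial := by
  rw [expMeasure, gammaMeasure, integral_withDensity_eq_integral_toReal_smul
    (measurable_gammaPDF 1 1) (by simp [gammaPDF]),
    gammaPDF_one_one_smul_pow, integral_indicator measurableSet_Ici, integral_Ici_eq_integral_Ioi,
    ← Real.Gamma_eq_integral (by positivity), Real.Gamma_nat_eq_factorial]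

theorem ae_nonneg_expMeasure_one : ∀ᵐ x ∂(expMeasure 1), 0 ≤ x := by
  rw [expMeasure, gammaMeasure, ae_withDensity_iff (measurable_gammaPDF 1 1)]
  refine Eventually.of_forall fun x hx => ?_
  by_contra h
  exact hx (gammaPDF_of_neg (not_le.1 h))

namespace Arrival

theorem integrable_pow (k : Arrival) (n : ℕ) : Integrable (fun x : ℝ => x ^ n) k.gapLaw := by
  cases k
  · exact integrable_dirac (by simp)
  · exact integrable_pow_expMeasure_one n

theorem integral_id (k : Arrival) : ∫ x, x ∂k.gapLaw = 1 := by
  cases k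
  · simp [gapLaw]
  · simpa [gapLaw] using integral_pow_expMeasure_one 1

theorem integral_sq_le (k : Arrival) : ∫ x, x ^ 2 ∂k.gapLaw ≤ 2 := by
  cases k
  · simp [gapLaw]
  · exact (integral_pow_expMeasure_one 2).le.trans (by norm_num)

theorem ae_nonneg (k : Arrival) : ∀ᵐ x ∂k.gapLaw, 0 ≤ x := by
  cases k
  · simp [gapLaw, ae_dirac_eq]
  · exact ae_nonneg_expMeasure_one

end Arrival

theorem measurable_rule {N J Act : Type*} [Countable J] [MeasurableSpace J]
    [MeasurableSingletonClass J] {s : Rule N J Act} (hs : ∀ j, @Measurable _ _ _ ⊤ (s j)) :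
    @Measurable (J × unitInterval) _ _ ⊤ (fun x => s x.1 x.2) := by
  let : MeasurableSpace (Decision N Act) := ⊤
  exact measurable_from_prod_countable_right hs

/-! ### Bucket contents and the drift of the squared deficit. -/

namespace Exchange

variable {N J B Act Alloc : Type*} [Fintype N] [DecidableEq N]
    [Fintype J] [MeasurableSpace J] [MeasurableSingletonClass J]
    [Fintype B] [MeasurableSpace B] [MeasurableSingletonClass B]
    [Fintype Act] [Fintype Alloc] [Nonempty Alloc]
    (E : Exchange N J B Act Alloc) (k : Arrival)

theorem integrable_gap_pow (t n : ℕ) : Integrable (fun ω => gap t ω ^ n) (E.prob k) := by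
  have := k.integrable_pow n
  rw [← E.map_gap k t] at this
  exact this.comp_measurable (by fun_prop)

theorem integral_gap (t : ℕ) : ∫ ω, gap t ω ∂(E.prob k) = 1 := by
  have := integral_map (μ := E.prob k) (φ := gap t) (f := fun x : ℝ => x) (by fun_prop)
    (by fun_prop)
  rw [← this, E.map_gap, k.integral_id]

theorem integral_gap_sq_le (t : ℕ) : ∫ ω, gap t ω ^ 2 ∂(E.prob k) ≤ 2 := by
  have := integral_map (μ := E.prob k) (φ := gap t) (f := fun x : ℝ => x ^ 2) (by fun_prop)
    (by fun_prop)
  rw [← this, E.map_gap]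
  exact k.integral_sq_le

theorem ae_gap_nonneg : ∀ᵐ ω ∂(E.prob k), ∀ t, 0 ≤ gap t ω := by
  refine ae_all_iff.2 fun t => ?_
  have := k.ae_nonneg
  rw [← E.map_gap k t] at this
  exact ae_of_ae_map (by fun_prop) this

/-- The probability that the rule `s` calls out network `i`. -/
def callProb (s : Rule N J Act) (i : N) : ℝ :=
  (E.marketLaw.toMeasure.prod (volume : Measure unitInterval)).real
    {x | i ∈ (s x.1.1 x.2).1}

variable {s : Rule N J Act} (hs : ∀ j, @Measurable _ _ _ ⊤ (s j)) (size : N → ℝ) (i : N)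

include hs

theorem measurableSet_call :
    MeasurableSet {x : (J × (N → B)) × unitInterval | i ∈ (s x.1.1 x.2).1} := by
  have h : Measurable (fun x : (J × (N → B)) × unitInterval => (x.1.1, x.2)) := by fun_prop
  exact (measurable_rule hs).comp h (show @MeasurableSet _ ⊤ {d : Decision N Act | i ∈ d.1} from trivial)

/-- The factorization omits the market and the seed of step `t`; this makes readiness of the bucket
independent of the current call-out and its reward. -/
theorem exists_bucket_eq (t : ℕ) : ∃ φ : (Finset.range t → Event N J B) × ℝ → ℝ, Measurable φ ∧
    ∀ ω, E.bucket size s ω i t = φ (past t ω, gap t ω) := by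
  induction t with
  | zero => exact ⟨fun _ => size i, measurable_const, fun _ => rfl⟩
  | succ t ih =>
    obtain ⟨φ, hφ, h⟩ := ih
    have hr : Measurable (fun x : (Finset.range (t + 1) → Event N J B) × ℝ =>
        ((fun r : Finset.range t => x.1 ⟨r, Finset.mem_range.2
          ((Finset.mem_range.1 r.2).trans t.lt_succ_self)⟩),
          (x.1 ⟨t, Finset.mem_range.2 t.lt_succ_self⟩).1)) := by fun_prop
    have hc : Measurable (fun x : (Finset.range (t + 1) → Event N J B) × ℝ =>
        (x.1 ⟨t, Finset.mem_range.2 t.lt_succ_self⟩).2) := by fun_prop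
    refine ⟨fun x => min (size i) (φ ((fun r : Finset.range t => x.1 ⟨r, Finset.mem_range.2
          ((Finset.mem_range.1 r.2).trans t.lt_succ_self)⟩),
          (x.1 ⟨t, Finset.mem_range.2 t.lt_succ_self⟩).1) -
        (if i ∈ (s (x.1 ⟨t, Finset.mem_range.2 t.lt_succ_self⟩).2.1.1
          (x.1 ⟨t, Finset.mem_range.2 t.lt_succ_self⟩).2.2).1 ∧
          1 ≤ φ ((fun r : Finset.range t => x.1 ⟨r, Finset.mem_range.2
          ((Finset.mem_range.1 r.2).trans t.lt_succ_self)⟩),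
          (x.1 ⟨t, Finset.mem_range.2 t.lt_succ_self⟩).1) then 1 else 0) + E.rate i * x.2),
      ?_, fun ω => ?_⟩
    · refine measurable_const.min (((hφ.comp hr).sub (Measurable.ite ?_ measurable_const
        measurable_const)).add (measurable_snd.const_mul _))
      exact (hc (measurableSet_call hs i)).inter ((hφ.comp hr) measurableSet_Ici)
    · rw [bucket, h ω]
      rfl

theorem measurable_bucket (t : ℕ) : Measurable (fun ω => E.bucket size s ω i t) := by
  obtain ⟨φ, hφ, h⟩ := E.exists_bucket_eq hs size i t
  simp_rw [h]
  fun_prop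

/-- The probability that the bucket of network `i` holds a token at arrival `t`. -/
def readyProb (E : Exchange N J B Act Alloc) (k : Arrival) (size : N → ℝ) (s : Rule N J Act)
    (i : N) (t : ℕ) : ℝ :=
  ∫ ω, (if 1 ≤ E.bucket size s ω i t then 1 else 0) ∂(E.prob k)

theorem integral_ready_mul {h : (J × (N → B)) × unitInterval → ℝ} (hh : Measurable h) (t : ℕ) :
    ∫ ω, (if 1 ≤ E.bucket size s ω i t then 1 else 0) * h (market t ω, seed t ω) ∂(E.prob k) =
      E.readyProb k size s i t * ∫ x, h x ∂(E.marketLaw.toMeasure.prod volume) := by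
  obtain ⟨φ, hφ, hb⟩ := E.exists_bucket_eq hs size i t
  have hq : Measurable (fun x => if 1 ≤ φ x then (1 : ℝ) else 0) :=
    Measurable.ite (hφ measurableSet_Ici) measurable_const measurable_const
  have hi := (E.indepFun_past_gap k t).comp hq hh
  rw [← E.map_snd k t, integral_map (by fun_prop) (by fun_prop), readyProb]
  simp_rw [hb]
  exact hi.integral_fun_mul_eq_mul_integral
    (hq.comp (by fun_prop)).aestronglyMeasurable (hh.comp (by fun_prop)).aestronglyMeasurable

theorem ae_bucket_mem (hsize : 0 ≤ size i) :
    ∀ᵐ ω ∂(E.prob k), ∀ t, E.bucket size s ω i t ∈ Set.Icc 0 (size i) := by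
  filter_upwards [E.ae_gap_nonneg k] with ω hω t
  induction t with
  | zero => exact ⟨hsize, le_rfl⟩
  | succ t ih =>
    refine ⟨?_, min_le_left _ _⟩
    rw [bucket]
    have := mul_nonneg (E.rate_nonneg i) (hω (t + 1))
    refine le_min hsize ?_
    split_ifs with h
    · linarith [h.2]
    · linarith [ih.1]

/-- Drift of the squared deficit of the bucket. -/
theorem integral_deficit_sq_succ_le (hsize : 1 < size i) (hp : E.callProb s i ≤ E.rate i) (t : ℕ) :
    ∫ ω, (size i - E.bucket size s ω i (t + 1)) ^ 2 ∂(E.prob k) ≤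
      ∫ ω, (size i - E.bucket size s ω i t) ^ 2 ∂(E.prob k) + 2 * E.callProb s i
        - 2 * E.callProb s i * (size i - 1) * (1 - E.readyProb k size s i t) := by
  classical
  obtain ⟨φ, hφ, hb⟩ := E.exists_bucket_eq hs size i t
  set p := E.callProb s i with hpdef
  set u := E.readyProb k size s i t with hu
  set P := E.prob k
  have hp0 : 0 ≤ p := measureReal_nonneg
  have hp1 : p ≤ 1 := hp.trans (E.rate_le_one i)
  let L : Path N J B → ℝ := fun ω => size i - E.bucket size s ω i t
  let U : Path N J B → ℝ := fun ω => if 1 ≤ E.bucket size s ω i t then 1 else 0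
  let χ : (J × (N → B)) × unitInterval → ℝ := fun x => if i ∈ (s x.1.1 x.2).1 then 1 else 0
  let X : Path N J B → ℝ := fun ω => χ (market t ω, seed t ω)
  let Y : Path N J B → ℝ := fun ω => U ω * X ω
  let g : Path N J B → ℝ := gap (t + 1)
  let q : (Finset.range t → Event N J B) × ℝ → ℝ := fun x => if 1 ≤ φ x then 1 else 0
  have hq : Measurable q := Measurable.ite (hφ measurableSet_Ici) measurable_const measurable_const
  have hχ : Measurable χ := Measurable.ite (measurableSet_call hs i) measurable_const measurable_const
  have hL : L = fun ω => size i - φ (past t ω, gap t ω) := by funext ω; simp only [L, hb]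
  have hU : U = fun ω => q (past t ω, gap t ω) := by funext ω; simp only [U, q, hb]
  have mL : Measurable L := by rw [hL]; fun_prop
  have mU : Measurable U := by rw [hU]; fun_prop
  have mX : Measurable X := hχ.comp (by fun_prop)
  have mY : Measurable Y := mU.mul mX
  have mg : Measurable g := measurable_gap _
  have U01 : ∀ ω, U ω = 0 ∨ U ω = 1 := fun ω => by
    simp only [U]; split_ifs <;> simp
  have X01 : ∀ ω, X ω = 0 ∨ X ω = 1 := fun ω => by
    simp only [X, χ]; split_ifs <;> simp
  have hmem := E.ae_bucket_mem k hs size i (by linarith)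
  have bL : ∀ᵐ ω ∂P, ‖L ω‖ ≤ size i := by
    filter_upwards [hmem] with ω hω
    have := hω t
    rw [Real.norm_eq_abs, abs_le]
    constructor <;> simp only [L] <;> linarith [this.1, this.2]
  have bU : ∀ᵐ ω ∂P, ‖U ω‖ ≤ 1 := Eventually.of_forall fun ω => by
    rcases U01 ω with h | h <;> simp [h]
  have bY : ∀ᵐ ω ∂P, ‖Y ω‖ ≤ 1 := Eventually.of_forall fun ω => by
    rcases U01 ω with h | h <;> rcases X01 ω with h' | h' <;> simp [Y, h, h']
  have iL : Integrable L P := Integrable.of_bound mL.aestronglyMeasurable _ bL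
  have iU : Integrable U P := Integrable.of_bound mU.aestronglyMeasurable _ bU
  have iY : Integrable Y P := Integrable.of_bound mY.aestronglyMeasurable _ bY
  have ig : Integrable g P := by simpa using E.integrable_gap_pow k (t + 1) 1
  have ig2 : Integrable (fun ω => g ω ^ 2) P := E.integrable_gap_pow k (t + 1) 2
  have iLL : Integrable (fun ω => L ω * L ω) P := iL.bdd_mul mL.aestronglyMeasurable bL
  have iLY : Integrable (fun ω => L ω * Y ω) P := iY.bdd_mul mL.aestronglyMeasurable bL
  have iLU : Integrable (fun ω => L ω * U ω) P := iU.bdd_mul mL.aestronglyMeasurable bL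
  have iLg : Integrable (fun ω => L ω * g ω) P := ig.bdd_mul mL.aestronglyMeasurable bL
  have iYg : Integrable (fun ω => Y ω * g ω) P := ig.bdd_mul mY.aestronglyMeasurable bY
  have eχ : ∫ x, χ x ∂(E.marketLaw.toMeasure.prod volume) = p := by
    rw [hpdef, callProb, ← integral_indicator_one (measurableSet_call hs i)]
    refine integral_congr_ae (Eventually.of_forall fun x => ?_)
    simp [χ, Set.indicator_apply]
  have eX : ∫ ω, X ω ∂P = p := by
    rw [← eχ, ← E.map_snd k t, integral_map (by fun_prop) (by fun_prop)]
  have eY : ∫ ω, Y ω ∂P = u * p := by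
    rw [← eχ]; exact E.integral_ready_mul k hs size i hχ t
  have eLY : ∫ ω, L ω * Y ω ∂P = (∫ ω, L ω * U ω ∂P) * p := by
    have hi := (E.indepFun_past_gap k t).comp (φ := fun x => (size i - φ x) * q x)
      (by fun_prop) hχ
    have := hi.integral_fun_mul_eq_mul_integral
      (Measurable.comp (by fun_prop) (by fun_prop)).aestronglyMeasurable
      (hχ.comp (by fun_prop)).aestronglyMeasurable
    rw [← eX, hL, hU]
    simp only [Y, hU, ← mul_assoc]
    exact this
  -- The refill gap belongs to event `t + 1`, hence is independent of everything up to event `t`,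
  -- including the call at `t`.
  have hnext : IndepFun (fun ω : Path N J B => ((past t ω, gap t ω), (market t ω, seed t ω))) g P := by
    have hr : Measurable (fun x : (Finset.range (t + 1) → Event N J B) =>
        ((((fun r : Finset.range t => x ⟨r, Finset.mem_range.2
          ((Finset.mem_range.1 r.2).trans t.lt_succ_self)⟩),
          (x ⟨t, Finset.mem_range.2 t.lt_succ_self⟩).1)),
          (x ⟨t, Finset.mem_range.2 t.lt_succ_self⟩).2)) := by fun_prop
    exact (E.indepFun_past k (t + 1)).comp hr measurable_fst
  have eg : ∫ ω, g ω ∂P = 1 := E.integral_gap k (t + 1)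
  have eLg : ∫ ω, L ω * g ω ∂P = ∫ ω, L ω ∂P := by
    have hi := hnext.comp (φ := fun x => size i - φ x.1) (ψ := id) (by fun_prop) measurable_id
    have hi' : IndepFun L g P := by rw [hL]; exact hi
    rw [hi'.integral_fun_mul_eq_mul_integral mL.aestronglyMeasurable mg.aestronglyMeasurable, eg,
      mul_one]
  have eYg : ∫ ω, Y ω * g ω ∂P = u * p := by
    have hi := hnext.comp (φ := fun x => q x.1 * χ x.2) (ψ := id) (by fun_prop) measurable_id
    have hi' : IndepFun Y g P := by simp only [Y, hU]; exact hi
    rw [hi'.integral_fun_mul_eq_mul_integral mY.aestronglyMeasurable mg.aestronglyMeasurable, eg,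
      mul_one, eY]
  have eg2 : ∫ ω, g ω ^ 2 ∂P ≤ 2 := E.integral_gap_sq_le k (t + 1)
  have hpt : ∀ᵐ ω ∂P, (size i - E.bucket size s ω i (t + 1)) ^ 2 ≤
      L ω * L ω + 2 * (L ω * Y ω) + Y ω - 2 * p * (L ω * g ω) - 2 * p * (Y ω * g ω)
        + p ^ 2 * g ω ^ 2 := by
    filter_upwards [E.ae_gap_nonneg k, hmem] with ω hg hω
    have hY : (if i ∈ (s (imp t ω) (seed t ω)).1 ∧ 1 ≤ E.bucket size s ω i t then (1 : ℝ) else 0)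
        = Y ω := by
      have : (i ∈ (s (imp t ω) (seed t ω)).1) = (i ∈ (s (market t ω).1 (seed t ω)).1) := rfl
      simp only [Y, U, X, χ, this]
      by_cases h1 : 1 ≤ E.bucket size s ω i t <;>
        by_cases h2 : i ∈ (s (market t ω).1 (seed t ω)).1 <;> simp [h1, h2]
    have hYY : Y ω * Y ω = Y ω := by
      rcases U01 ω with h | h <;> rcases X01 ω with h' | h' <;> simp [Y, h, h']
    -- The refill rate is lowered to `p`, so that refill and attempted calls balance on average; the
    -- maximum with `0` accounts for overflow.
    have hs1 : size i - E.bucket size s ω i (t + 1) ≤ max 0 (L ω + Y ω - p * g ω) := by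
      rw [bucket, hY]
      have : p * g ω ≤ E.rate i * g ω := mul_le_mul_of_nonneg_right hp (hg _)
      rcases min_cases (size i) (E.bucket size s ω i t - Y ω + E.rate i * gap (t + 1) ω) with h | h
      · rw [h.1]; simp
      · rw [h.1]
        refine le_max_of_le_right ?_
        simp only [L, g] at this ⊢
        linarith
    have hs0 : 0 ≤ size i - E.bucket size s ω i (t + 1) := by linarith [(hω (t + 1)).2]
    have hsq : (size i - E.bucket size s ω i (t + 1)) ^ 2 ≤ (L ω + Y ω - p * g ω) ^ 2 := by
      rcases max_cases 0 (L ω + Y ω - p * g ω) with h | h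
      · rw [h.1] at hs1
        rw [le_antisymm hs1 hs0, sq, zero_mul]
        exact sq_nonneg _
      · rw [h.1] at hs1
        exact pow_le_pow_left₀ hs0 hs1 2
    refine hsq.trans (le_of_eq ?_)
    linear_combination hYY
  have i1 : Integrable (fun ω => L ω * L ω + 2 * (L ω * Y ω)) P := iLL.add (iLY.const_mul 2)
  have i2 : Integrable (fun ω => L ω * L ω + 2 * (L ω * Y ω) + Y ω) P := i1.add iY
  have i3 : Integrable (fun ω => L ω * L ω + 2 * (L ω * Y ω) + Y ω - 2 * p * (L ω * g ω)) P :=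
    i2.sub (iLg.const_mul (2 * p))
  have i4 : Integrable (fun ω => L ω * L ω + 2 * (L ω * Y ω) + Y ω - 2 * p * (L ω * g ω)
      - 2 * p * (Y ω * g ω)) P := i3.sub (iYg.const_mul (2 * p))
  have i5 : Integrable (fun ω => L ω * L ω + 2 * (L ω * Y ω) + Y ω - 2 * p * (L ω * g ω)
      - 2 * p * (Y ω * g ω) + p ^ 2 * g ω ^ 2) P := i4.add (ig2.const_mul (p ^ 2))
  have h1 := integral_mono_of_nonneg (μ := P) (Eventually.of_forall fun ω => sq_nonneg _) i5 hpt
  have h2 : ∫ ω, (L ω * L ω + 2 * (L ω * Y ω) + Y ω - 2 * p * (L ω * g ω)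
      - 2 * p * (Y ω * g ω) + p ^ 2 * g ω ^ 2) ∂P =
      ∫ ω, L ω * L ω ∂P + 2 * ((∫ ω, L ω * U ω ∂P) * p) + u * p - 2 * p * ∫ ω, L ω ∂P
        - 2 * p * (u * p) + p ^ 2 * ∫ ω, g ω ^ 2 ∂P := by
    rw [integral_add i4 (ig2.const_mul (p ^ 2)), integral_sub i3 (iYg.const_mul (2 * p)),
      integral_sub i2 (iLg.const_mul (2 * p)), integral_add i1 iY,
      integral_add iLL (iLY.const_mul 2),
      integral_const_mul, integral_const_mul, integral_const_mul, integral_const_mul,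
      eLY, eY, eLg, eYg]
  -- The difference is the integral of `L * (1 - U)`, and `L > size i - 1` wherever the bucket is
  -- not ready. This is the source of the negative drift.
  have h3 : (size i - 1) * (1 - u) ≤ ∫ ω, L ω ∂P - ∫ ω, L ω * U ω ∂P := by
    have eu : ∫ ω, U ω ∂P = u := rfl
    rw [← integral_sub iL iLU]
    have : (size i - 1) * (1 - u) = ∫ ω, (size i - 1) * (1 - U ω) ∂P := by
      rw [integral_const_mul, integral_sub (integrable_const _) iU, eu]
      simp
    rw [this]
    refine integral_mono (((integrable_const _).sub iU).const_mul _) (iL.sub iLU) fun ω => ?_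
    by_cases h : 1 ≤ E.bucket size s ω i t
    · simp [U, h]
    · simp only [U, L, h, if_false]
      push Not at h
      linarith
  have hu0 : 0 ≤ u := integral_nonneg fun ω => by
    show (0 : ℝ) ≤ if _ then _ else _
    split_ifs <;> norm_num
  have hu1 : u ≤ 1 := by
    have := integral_mono iU (integrable_const (1 : ℝ)) fun ω => by
      show U ω ≤ 1
      rcases U01 ω with h | h <;> simp [h]
    rw [integral_const] at this
    exact this.trans (by simp)
  have e0 : ∫ ω, (size i - E.bucket size s ω i t) ^ 2 ∂P = ∫ ω, L ω * L ω ∂P := by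
    simp only [L, sq]
  rw [e0]
  refine h1.trans (h2.le.trans ?_)
  have h4 : p ^ 2 * ∫ ω, g ω ^ 2 ∂P ≤ p ^ 2 * 2 := mul_le_mul_of_nonneg_left eg2 (sq_nonneg p)
  have h5 := mul_le_mul_of_nonneg_left h3 (show 0 ≤ 2 * p by positivity)
  -- The remaining terms `p * u - 2 * p ^ 2 * u + 2 * p ^ 2` fall short of `2 * p` by exactly `2 * p
  -- * (1 - u) * (1 - p) + p * u`.
  have h6 : 0 ≤ p * ((1 - u) * (1 - p)) :=
    mul_nonneg hp0 (mul_nonneg (by linarith) (by linarith))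
  have h7 : 0 ≤ p * u := mul_nonneg hp0 hu0
  nlinarith

/-- The drift inequality telescopes. The full initial bucket gives potential zero, and the final
potential is dropped as nonnegative. Dividing by `2 * callProb` is what requires this probability to
be nonzero. -/
theorem sum_readyProb_ge (hsize : 1 < size i) (hp : E.callProb s i ≤ E.rate i)
    (hp0 : E.callProb s i ≠ 0) (T : ℕ) :
    (1 - 1 / (size i - 1)) * T ≤ ∑ t ∈ Finset.range T, E.readyProb k size s i t := by
  have hpos : 0 < E.callProb s i := lt_of_le_of_ne measureReal_nonneg hp0.symm
  have key : ∀ T : ℕ, 2 * E.callProb s i * (size i - 1) *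
      ∑ t ∈ Finset.range T, (1 - E.readyProb k size s i t) +
      ∫ ω, (size i - E.bucket size s ω i T) ^ 2 ∂(E.prob k) ≤ 2 * E.callProb s i * T := by
    intro T
    induction T with
    | zero => simp [bucket]
    | succ T ih =>
      have := E.integral_deficit_sq_succ_le k hs size i hsize hp T
      rw [Finset.sum_range_succ]
      push_cast
      linarith
  have h1 := key T
  have h2 : 0 ≤ ∫ ω, (size i - E.bucket size s ω i T) ^ 2 ∂(E.prob k) :=
    integral_nonneg fun ω => sq_nonneg _
  have h3 : (size i - 1) * ∑ t ∈ Finset.range T, (1 - E.readyProb k size s i t) ≤ T := by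
    refine le_of_mul_le_mul_left ?_ (show 0 < 2 * E.callProb s i by positivity)
    linarith
  have h4 : ∑ t ∈ Finset.range T, (1 - E.readyProb k size s i t) ≤ T / (size i - 1) := by
    rw [le_div_iff₀ (by linarith)]
    linarith
  rw [Finset.sum_sub_distrib] at h4
  simp only [Finset.sum_const, Finset.card_range, nsmul_eq_mul, mul_one] at h4
  rw [sub_mul, one_mul, div_mul_eq_mul_div, one_mul]
  linarith

end Exchange


/-! ### Memoryless rules as limit points of decision frequencies. -/

theorem _root_.MapClusterPt.le_of_eventually_le {X ι : Type*} [TopologicalSpace X] {F : Filter ι}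
    {u : ι → X} {x : X} (hx : MapClusterPt x F u) {φ : X → ℝ} (hφ : Continuous φ) {c : ℝ}
    (h : ∀ ε > 0, ∀ᶠ n in F, φ (u n) ≤ c + ε) : φ x ≤ c := by
  refine le_of_forall_pos_le_add fun ε hε => ?_
  by_contra hlt
  push Not at hlt
  have h1 : ∀ᶠ y in 𝓝 x, c + ε < φ y := hφ.continuousAt.eventually_const_lt hlt
  obtain ⟨n, hn, hn'⟩ := ((hx.frequently h1).and_eventually (h ε hε)).exists
  exact absurd hn' (not_le.2 hn)

namespace Exchange

variable {N J B Act Alloc : Type*} [Fintype N] [DecidableEq N]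
    [Fintype J] [MeasurableSpace J] [MeasurableSingletonClass J]
    [Fintype B] [MeasurableSpace B] [MeasurableSingletonClass B]
    [Fintype Act] [Fintype Alloc] [Nonempty Alloc]
    (E : Exchange N J B Act Alloc) (k : Arrival)

/-- Expected frequency of the pairs (impression, decision) in the first `T` arrivals, for either
arrival model. -/
def decisionFreq (A : Policy N J B Act) (T : ℕ) (p : J × Decision N Act) : ℝ :=
  (∑ t ∈ Finset.range T, (E.prob k).real {ω | imp t ω = p.1 ∧ A t ω = p.2}) / T

variable {E k} {A : Policy N J B Act}

theorem integral_decision (hA : NonAnticipating A) (t : ℕ) (f : J × Decision N Act → ℝ) :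
    ∫ ω, f (imp t ω, A t ω) ∂(E.prob k) =
      ∑ p, (E.prob k).real {ω | imp t ω = p.1 ∧ A t ω = p.2} * f p := by
  let : MeasurableSpace (Decision N Act) := ⊤
  have : DiscreteMeasurableSpace (Decision N Act) := ⟨fun _ => trivial⟩
  have hm : Measurable (fun ω => ((imp t ω, A t ω) : J × Decision N Act)) :=
    (measurable_imp t).prodMk (hA.measurable t)
  have h1 := integral_map (μ := E.prob k) hm.aemeasurable (f := f)
    (Measurable.of_discrete.aestronglyMeasurable)
  rw [← h1, integral_fintype (Integrable.of_finite)]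
  refine Finset.sum_congr rfl fun p _ => ?_
  rw [map_measureReal_apply hm (MeasurableSet.singleton _), smul_eq_mul]
  congr 2
  ext ω
  simp [Prod.ext_iff]

theorem sum_decisionFreq_mul (hA : NonAnticipating A) (T : ℕ) (f : J × Decision N Act → ℝ) :
    ∑ p, E.decisionFreq k A T p * f p =
      (∑ t ∈ Finset.range T, ∫ ω, f (imp t ω, A t ω) ∂(E.prob k)) / T := by
  simp_rw [integral_decision hA, decisionFreq, div_mul_eq_mul_div, Finset.sum_mul]
  rw [← Finset.sum_div, Finset.sum_comm]

theorem decisionFreq_mem (A : Policy N J B Act) (T : ℕ) (p : J × Decision N Act) :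
    E.decisionFreq k A T p ∈ Set.Icc (0 : ℝ) 1 := by
  refine ⟨div_nonneg (Finset.sum_nonneg fun _ _ => measureReal_nonneg) (Nat.cast_nonneg _), ?_⟩
  refine div_le_one_of_le₀ ?_ (Nat.cast_nonneg _)
  calc _ ≤ ∑ t ∈ Finset.range T, (1 : ℝ) := Finset.sum_le_sum fun _ _ => measureReal_le_one
    _ = T := by simp

theorem sum_decisionFreq_fst (hA : NonAnticipating A) {T : ℕ} (hT : T ≠ 0) (j : J) :
    ∑ d, E.decisionFreq k A T (j, d) = (E.D j).toReal := by
  classical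
  have h := sum_decisionFreq_mul (E := E) (k := k) hA T (fun p => if p.1 = j then 1 else 0)
  have h1 : ∀ t, ∫ ω, (if imp t ω = j then (1 : ℝ) else 0) ∂(E.prob k) = (E.D j).toReal := by
    intro t
    rw [← E.prob_imp k t, ← integral_indicator_one ((measurable_imp t) (MeasurableSet.singleton j))]
    refine integral_congr_ae (Eventually.of_forall fun ω => ?_)
    simp [Set.indicator_apply]
  simp only [h1] at h
  rw [Fintype.sum_prod_type] at h
  simp only [mul_ite, mul_one, mul_zero, Finset.sum_const, Finset.card_range, nsmul_eq_mul] at h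
  rw [Finset.sum_eq_single j (fun j' _ hj => by simp [hj]) (by simp),
    mul_div_cancel_left₀ _ (Nat.cast_ne_zero.2 hT)] at h
  simpa using h

/-- For each impression of positive probability, normalizing `q` gives a conditional law of
decisions, which is the image of the uniform law under some measurable map of the seed. -/
theorem exists_rule {q : J × Decision N Act → ℝ} (hq : ∀ p, 0 ≤ q p)
    (hsum : ∀ j, ∑ d, q (j, d) = (E.D j).toReal) :
    ∃ s : Rule N J Act, (∀ j, @Measurable _ _ _ ⊤ (s j)) ∧ E.ruleFrequency s = q := by
  let : MeasurableSpace (Decision N Act) := ⊤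
  have : DiscreteMeasurableSpace (Decision N Act) := ⟨fun _ => trivial⟩
  -- `Act` might be empty, but the row of `q` at an impression of positive probability cannot be an
  -- empty sum.
  have hne : Nonempty (Decision N Act) := by
    by_contra h
    rw [not_nonempty_iff] at h
    obtain ⟨j, hj⟩ := E.D.support_nonempty
    have := hsum j
    rw [Finset.univ_eq_empty, Finset.sum_empty] at this
    exact (ENNReal.toReal_pos ((PMF.mem_support_iff _ _).1 hj) (PMF.apply_ne_top _ _)).ne this
  have key : ∀ j, ∃ f : unitInterval → Decision N Act, Measurable f ∧
      ∀ d, (E.D j).toReal * (volume : Measure unitInterval).real {u | f u = d} = q (j, d) := by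
    intro j
    rcases eq_or_ne (E.D j).toReal 0 with h0 | h0
    · refine ⟨fun _ => Classical.choice hne, measurable_const, fun d => ?_⟩
      have := (Finset.sum_eq_zero_iff_of_nonneg fun d _ => hq (j, d)).1 ((hsum j).trans h0) d
        (Finset.mem_univ d)
      rw [h0, zero_mul, this]
    · have hpos : 0 < (E.D j).toReal := lt_of_le_of_ne ENNReal.toReal_nonneg h0.symm
      let μ : PMF (Decision N Act) := PMF.ofFintype
        (fun d => ENNReal.ofReal (q (j, d) / (E.D j).toReal)) (by
          rw [← ENNReal.ofReal_sum_of_nonneg fun d _ => div_nonneg (hq _) hpos.le,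
            ← Finset.sum_div, hsum, div_self h0, ENNReal.ofReal_one])
      have : IsProbabilityMeasure μ.toMeasure := PMF.toMeasure.isProbabilityMeasure _
      obtain ⟨f, hf, hmap⟩ := μ.toMeasure.exists_measurable_map_eq
      refine ⟨f, hf, fun d => ?_⟩
      have h1 : {u | f u = d} = f ⁻¹' {d} := rfl
      rw [h1, ← map_measureReal_apply hf (MeasurableSet.singleton d), hmap, measureReal_def,
        PMF.toMeasure_apply_singleton _ _ (MeasurableSet.singleton _), PMF.ofFintype_apply,
        ENNReal.toReal_ofReal (div_nonneg (hq _) hpos.le), mul_div_cancel₀ _ h0]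
  choose s hs h using key
  exact ⟨s, hs, funext fun p => h p.1 p.2⟩

/-- Compactness of the cube gives a limit point. Its impression marginals are still those of `D`,
since for `T ≠ 0` they are constant along the sequence and depend continuously on the frequencies.
-/
theorem exists_rule_mapClusterPt (k : Arrival) (hA : NonAnticipating A) :
    ∃ s : Rule N J Act, (∀ j, @Measurable _ _ _ ⊤ (s j)) ∧
      MapClusterPt (E.ruleFrequency s) atTop (E.decisionFreq k A) := by
  obtain ⟨q, hq, hc⟩ := (isCompact_Icc (a := (0 : J × Decision N Act → ℝ)) (b := 1)).exists_mapClusterPt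
    (f := atTop) (u := E.decisionFreq k A) (by
      refine tendsto_principal.2 (Eventually.of_forall fun T => ?_)
      exact ⟨fun p => (decisionFreq_mem A T p).1, fun p => (decisionFreq_mem A T p).2⟩)
  have hev : ∀ j, ∀ᶠ T in atTop, ∑ d, E.decisionFreq k A T (j, d) = (E.D j).toReal := fun j => by
    filter_upwards [eventually_ne_atTop 0] with T hT using sum_decisionFreq_fst hA hT j
  have hcont : ∀ j, Continuous fun q : J × Decision N Act → ℝ => ∑ d, q (j, d) := fun j => by
    fun_prop
  obtain ⟨s, hs, rfl⟩ := E.exists_rule (q := q) (fun p => hq.1 p) fun j => by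
    refine le_antisymm ?_ ?_
    · refine hc.le_of_eventually_le (hcont j) fun ε hε => ?_
      filter_upwards [hev j] with T hT
      linarith
    · have := hc.le_of_eventually_le (hcont j).neg (c := -(E.D j).toReal) fun ε hε => by
        filter_upwards [hev j] with T hT
        simp only [Pi.neg_apply, hT]
        linarith
      exact neg_le_neg_iff.1 this
  exact ⟨s, hs, hc⟩

variable {s : Rule N J Act} (hs : ∀ j, @Measurable _ _ _ ⊤ (s j))

theorem measurable_imp_seed (A : Policy N J B Act) {r t : ℕ} (h : r ≤ t) :
    Measurable[info A t] (fun ω : Path N J B => (gap r ω, imp r ω, seed r ω)) :=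
  Measurable.of_comap_le (le_sup_of_le_left (le_iSup₂_of_le r h le_rfl))

include hs

theorem measurable_rule_info (A : Policy N J B Act) {r t : ℕ} (h : r ≤ t) :
    @Measurable _ _ (info A t) ⊤ (fun ω : Path N J B => s (imp r ω) (seed r ω)) := by
  have h1 : Measurable (fun x : ℝ × J × unitInterval => (x.2.1, x.2.2)) := by fun_prop
  exact ((measurable_rule hs).comp h1).comp (measurable_imp_seed A h)

theorem nonAnticipating_applyRule : NonAnticipating (applyRule s : Policy N J B Act) :=
  fun t => measurable_rule_info hs _ (le_refl t)

/-- Only gaps, impressions and seeds enter the recursion. They are known to every policy `A`, which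
avoids circularity when `A` is the throttled policy itself. -/
theorem measurable_bucket_info (size : N → ℝ) (A : Policy N J B Act) (i : N) {r t : ℕ}
    (h : r ≤ t) : Measurable[info A t] (fun ω => E.bucket size s ω i r) := by
  induction r with
  | zero => exact measurable_const
  | succ r ih =>
    have hb := ih (r.le_succ.trans h)
    have hg : Measurable[info A t] (fun ω : Path N J B => gap (r + 1) ω) := by
      have h1 : Measurable (fun x : ℝ × J × unitInterval => x.1) := measurable_fst
      exact h1.comp (measurable_imp_seed A h)
    have hc : MeasurableSet[info A t] {ω : Path N J B | i ∈ (s (imp r ω) (seed r ω)).1} :=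
      measurable_rule_info hs A (r.le_succ.trans h)
        (show @MeasurableSet _ ⊤ {d : Decision N Act | i ∈ d.1} from trivial)
    exact measurable_const.min ((hb.sub (Measurable.ite (hc.inter (hb measurableSet_Ici))
      measurable_const measurable_const)).add (hg.const_mul _))

theorem nonAnticipating_throttle (size : N → ℝ) : NonAnticipating (E.throttle size s) := by
  intro t
  let : MeasurableSpace (Decision N Act) := ⊤
  have : DiscreteMeasurableSpace (Decision N Act) := ⟨fun _ => trivial⟩
  have h1 : Measurable[info (E.throttle size s) t]
      (fun ω : Path N J B => fun i : N => decide (1 ≤ E.bucket size s ω i t)) := by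
    refine @measurable_pi_lambda _ _ _ (info (E.throttle size s) t) _ _ fun i => ?_
    refine @measurable_to_bool _ (info (E.throttle size s) t) _ ?_
    have : (fun ω : Path N J B => decide (1 ≤ E.bucket size s ω i t)) ⁻¹' {true} =
        (fun ω => E.bucket size s ω i t) ⁻¹' Set.Ici 1 := by
      ext ω; simp
    rw [this]
    exact measurable_bucket_info hs size _ i le_rfl measurableSet_Ici
  have h2 : Measurable (fun x : Decision N Act × (N → Bool) =>
      ((x.1.1.filter fun i => x.2 i = true, x.1.2) : Decision N Act)) := Measurable.of_discrete
  have h3 := h2.comp ((measurable_rule_info hs _ (le_refl t)).prodMk h1)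
  have h4 : E.throttle size s t = (fun x : Decision N Act × (N → Bool) =>
      ((x.1.1.filter fun i => x.2 i = true, x.1.2) : Decision N Act)) ∘ fun ω : Path N J B =>
      (s (imp t ω) (seed t ω), fun i : N => decide (1 ≤ E.bucket size s ω i t)) := by
    funext ω
    simp only [throttle, Function.comp_apply, decide_eq_true_eq]
  rw [h4]
  exact h3

omit hs in
theorem tokens_throttle (E : Exchange N J B Act Alloc) (size : N → ℝ) (s : Rule N J Act)
    (ω : Path N J B) (i : N) (t : ℕ) :
    E.tokens size (E.throttle size s) ω i t = E.bucket size s ω i t := by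
  induction t with
  | zero => rfl
  | succ t ih =>
    rw [tokens, bucket, ih]
    simp [throttle]

theorem tokenAdmissible_throttle (k : Arrival) (size : N → ℝ) :
    E.TokenAdmissible size k (E.throttle size s) := by
  refine ⟨nonAnticipating_throttle hs size, Eventually.of_forall fun ω t i hi => ?_⟩
  rw [tokens_throttle]
  exact (Finset.mem_filter.1 hi).2

theorem prob_applyRule (k : Arrival) (t : ℕ) (p : J × Decision N Act) :
    (E.prob k).real {ω | imp t ω = p.1 ∧ applyRule s t ω = p.2} = E.ruleFrequency s p := by
  have hm : MeasurableSet {u | s p.1 u = p.2} :=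
    hs p.1 (show @MeasurableSet _ ⊤ {p.2} from trivial)
  have h1 : {ω : Path N J B | imp t ω = p.1 ∧ applyRule s t ω = p.2} =
      imp t ⁻¹' {p.1} ∩ seed t ⁻¹' {u | s p.1 u = p.2} := by
    ext ω
    simp only [Set.mem_ofPred_eq, Set.mem_inter_iff, Set.mem_preimage, Set.mem_singleton_iff,
      applyRule]
    constructor <;> rintro ⟨h, h'⟩
    · exact ⟨h, h ▸ h'⟩
    · exact ⟨h, h.symm ▸ h'⟩
  have hi : IndepFun (imp t) (seed t) (E.prob k) :=
    (E.indepFun_seed_market k t).comp measurable_fst measurable_id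
  rw [h1, measureReal_def, hi.measure_inter_preimage_eq_mul _ _ (MeasurableSet.singleton _) hm,
    ENNReal.toReal_mul, ← measureReal_def, prob_imp, ← measureReal_def,
    ← map_measureReal_apply (by fun_prop) hm, map_seed]
  rfl

theorem decisionFreq_applyRule (k : Arrival) {T : ℕ} (hT : T ≠ 0) :
    E.decisionFreq k (applyRule s) T = E.ruleFrequency s := by
  funext p
  simp only [decisionFreq, prob_applyRule hs, Finset.sum_const, Finset.card_range, nsmul_eq_mul]
  exact mul_div_cancel_left₀ _ (Nat.cast_ne_zero.2 hT)

theorem isMemorylessVersion_applyRule : E.IsMemorylessVersion (applyRule s) s := by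
  refine ⟨hs, Tendsto.mapClusterPt ?_⟩
  refine tendsto_const_nhds.congr' ?_
  filter_upwards [eventually_ne_atTop 0] with T hT
  exact (decisionFreq_applyRule hs .uniform hT).symm

theorem callProb_eq_sum (i : N) :
    E.callProb s i = ∑ p, E.ruleFrequency s p * (if i ∈ p.2.1 then 1 else 0) := by
  have h := integral_decision (E := E) (k := .uniform) (nonAnticipating_applyRule hs) 0
    (fun p => if i ∈ p.2.1 then 1 else 0)
  simp_rw [prob_applyRule hs] at h
  rw [← h, callProb, ← integral_indicator_one (measurableSet_call hs i), ← E.map_snd .uniform 0,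
    integral_map (by fun_prop)
      ((measurable_one.indicator (measurableSet_call hs i)).aestronglyMeasurable)]
  refine integral_congr_ae (Eventually.of_forall fun ω => ?_)
  simp only [Set.indicator_apply, applyRule, Pi.one_apply, Set.mem_ofPred_eq, market, imp]
  congr

theorem callProb_le_of_mapClusterPt {k : Arrival} (hA : NonAnticipating A)
    (hc : MapClusterPt (E.ruleFrequency s) atTop (E.decisionFreq k A)) {i : N} {c : ℝ}
    (h : ∀ ε > 0, ∀ᶠ T : ℕ in atTop, (∑ t ∈ Finset.range T,
      ∫ ω, (if i ∈ (A t ω).1 then (1 : ℝ) else 0) ∂(E.prob k)) / T ≤ c + ε) :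
    E.callProb s i ≤ c := by
  rw [callProb_eq_sum hs]
  refine hc.le_of_eventually_le
    (φ := fun q => ∑ p : J × Decision N Act, q p * (if i ∈ p.2.1 then 1 else 0)) (by fun_prop) ?_
  intro ε hε
  filter_upwards [h ε hε] with T hT
  rw [sum_decisionFreq_mul hA]
  exact hT

end Exchange

namespace Exchange

variable {N J B Act Alloc : Type*} [Fintype N] [DecidableEq N]
    [Fintype J] [MeasurableSpace J] [MeasurableSingletonClass J]
    [Fintype B] [MeasurableSpace B] [MeasurableSingletonClass B]
    [Fintype Act] [Fintype Alloc] [Nonempty Alloc]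
    {E : Exchange N J B Act Alloc} {k : Arrival} {A : Policy N J B Act}

/-! ### Call-out rates in the two models. -/

section Rates

theorem measurableSet_mem (hA : NonAnticipating A) (t : ℕ) (i : N) :
    MeasurableSet {ω | i ∈ (A t ω).1} :=
  hA.measurable t (show @MeasurableSet _ ⊤ {d : Decision N Act | i ∈ d.1} from trivial)

theorem measurable_call (hA : NonAnticipating A) (t : ℕ) (i : N) :
    Measurable (fun ω => if i ∈ (A t ω).1 then (1 : ℝ) else 0) :=
  Measurable.ite (measurableSet_mem hA t i) measurable_const measurable_const

theorem integrable_call (hA : NonAnticipating A) (t : ℕ) (i : N) :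
    Integrable (fun ω => if i ∈ (A t ω).1 then (1 : ℝ) else 0) (E.prob k) :=
  Integrable.of_bound (measurable_call hA t i).aestronglyMeasurable 1
    (Eventually.of_forall fun ω => by split_ifs <;> simp)

theorem TimeAverageAdmissible.eventually_callRate_le (h : E.TimeAverageAdmissible k A) (i : N) :
    ∀ ε > 0, ∀ᶠ T : ℕ in atTop, (∑ t ∈ Finset.range T,
      ∫ ω, (if i ∈ (A t ω).1 then (1 : ℝ) else 0) ∂(E.prob k)) / T ≤ E.rate i + ε := by
  intro ε hε
  let c : ℕ → Path N J B → ℝ := fun T ω =>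
    (∑ t ∈ Finset.range T, if i ∈ (A t ω).1 then (1 : ℝ) else 0) / T
  have mc : ∀ T, Measurable (c T) := fun T =>
    (Finset.measurable_sum _ fun t _ => measurable_call h.1 t i).div_const _
  have c0 : ∀ T ω, 0 ≤ c T ω := fun T ω => div_nonneg
    (Finset.sum_nonneg fun t _ => by split_ifs <;> norm_num) (Nat.cast_nonneg _)
  have c1 : ∀ T ω, c T ω ≤ 1 := fun T ω => by
    refine div_le_one_of_le₀ ?_ (Nat.cast_nonneg _)
    calc _ ≤ ∑ t ∈ Finset.range T, (1 : ℝ) :=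
          Finset.sum_le_sum fun t _ => by split_ifs <;> norm_num
      _ = T := by simp
  have hr := E.rate_nonneg i
  -- The almost sure `limsup` bound makes this excess vanish eventually on almost every path;
  -- dominated convergence turns it into a bound in expectation.
  let F : ℕ → Path N J B → ℝ := fun T ω => max (c T ω - (E.rate i + ε / 2)) 0
  have mF : ∀ T, Measurable (F T) := fun T => ((mc T).sub_const _).max measurable_const
  have bF : ∀ T, ∀ᵐ ω ∂(E.prob k), ‖F T ω‖ ≤ 1 := fun T => Eventually.of_forall fun ω => by
    rw [Real.norm_of_nonneg (le_max_right _ _)]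
    exact max_le (by linarith [c1 T ω]) zero_le_one
  have hF : ∀ᵐ ω ∂(E.prob k), Tendsto (fun T => F T ω) atTop (𝓝 0) := by
    filter_upwards [h.2] with ω hω
    refine tendsto_const_nhds.congr' ?_
    filter_upwards [hω i (ε / 2) (by positivity), eventually_gt_atTop 0] with T hT hT0
    refine (max_eq_right ?_).symm
    have : c T ω ≤ E.rate i + ε / 2 := by
      simp only [c, Finset.sum_boole]
      rwa [div_le_iff₀ (Nat.cast_pos.2 hT0)]
    linarith
  have hlim := tendsto_integral_of_dominated_convergence (μ := E.prob k) (F := F)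
    (f := fun _ => 0) (fun _ => (1 : ℝ)) (fun T => (mF T).aestronglyMeasurable)
    (integrable_const _) bF hF
  rw [integral_zero] at hlim
  filter_upwards [hlim.eventually_lt_const (show (0 : ℝ) < ε / 2 by positivity)] with T hT
  have e1 : (∑ t ∈ Finset.range T,
      ∫ ω, (if i ∈ (A t ω).1 then (1 : ℝ) else 0) ∂(E.prob k)) / T = ∫ ω, c T ω ∂(E.prob k) := by
    rw [integral_div, integral_finsetSum _ fun t _ => integrable_call h.1 t i]
  have iF : Integrable (F T) (E.prob k) := Integrable.of_bound (mF T).aestronglyMeasurable 1 (bF T)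
  have ic : Integrable (c T) (E.prob k) := Integrable.of_bound (mc T).aestronglyMeasurable 1
    (Eventually.of_forall fun ω => by rw [Real.norm_of_nonneg (c0 T ω)]; exact c1 T ω)
  have e2 : ∫ ω, c T ω ∂(E.prob k) ≤ ∫ ω, ((E.rate i + ε / 2) + F T ω) ∂(E.prob k) :=
    integral_mono ic ((integrable_const _).add iF) fun ω => by
      have := le_max_left (c T ω - (E.rate i + ε / 2)) 0
      show c T ω ≤ (E.rate i + ε / 2) + max _ _
      linarith
  rw [integral_add (integrable_const _) iF, integral_const] at e2
  rw [e1]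
  simp only [probReal_univ, one_smul] at e2
  linarith

/-- Tokens used never exceed the initial content plus the tokens generated. In expectation this is
`size i + rate i * T`, and the first term is negligible after division by `T`. -/
theorem TokenAdmissible.eventually_callRate_le {size : N → ℝ} (h : E.TokenAdmissible size k A)
    {i : N} (hsize : 0 ≤ size i) :
    ∀ ε > 0, ∀ᶠ T : ℕ in atTop, (∑ t ∈ Finset.range T,
      ∫ ω, (if i ∈ (A t ω).1 then (1 : ℝ) else 0) ∂(E.prob k)) / T ≤ E.rate i + ε := by
  have hpt : ∀ᵐ ω ∂(E.prob k), ∀ T, 0 ≤ E.tokens size A ω i T ∧ E.tokens size A ω i T +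
      ∑ t ∈ Finset.range T, (if i ∈ (A t ω).1 then (1 : ℝ) else 0) ≤
        size i + ∑ t ∈ Finset.range T, E.rate i * gap (t + 1) ω := by
    filter_upwards [h.2, E.ae_gap_nonneg k] with ω hω hg T
    induction T with
    | zero => simp [tokens, hsize]
    | succ T ih =>
      have h1 := mul_nonneg (E.rate_nonneg i) (hg (T + 1))
      rw [tokens, Finset.sum_range_succ, Finset.sum_range_succ]
      constructor
      · refine le_min hsize ?_
        split_ifs with hi
        · linarith [hω T i hi]
        · linarith [ih.1]
      · have h2 := min_le_right (size i) (E.tokens size A ω i T -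
          (if i ∈ (A T ω).1 then 1 else 0) + E.rate i * gap (T + 1) ω)
        linarith [ih.2]
  have hint : ∀ T : ℕ, ∑ t ∈ Finset.range T,
      ∫ ω, (if i ∈ (A t ω).1 then (1 : ℝ) else 0) ∂(E.prob k) ≤ size i + E.rate i * T := by
    intro T
    have ig : ∀ t, Integrable (fun ω => E.rate i * gap (t + 1) ω) (E.prob k) := fun t =>
      (show Integrable (gap (t + 1)) (E.prob k) by
        simpa using E.integrable_gap_pow k (t + 1) 1).const_mul _
    rw [← integral_finsetSum _ fun t _ => integrable_call h.1 t i]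
    have := integral_mono_ae (μ := E.prob k)
      (integrable_finsetSum (Finset.range T) fun t _ => integrable_call h.1 t i)
      ((integrable_const (size i)).add (integrable_finsetSum (Finset.range T) fun t _ => ig t)) (by
        filter_upwards [hpt] with ω hω
        simp only [Pi.add_apply]
        linarith [(hω T).1, (hω T).2])
    refine this.trans (le_of_eq ?_)
    simp only [Pi.add_apply]
    rw [integral_add (integrable_const _) (integrable_finsetSum (Finset.range T) fun t _ => ig t),
      integral_finsetSum _ fun t _ => ig t]
    simp_rw [integral_const_mul, E.integral_gap k]
    simp [mul_comm]
  intro ε hε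
  have hlim : Tendsto (fun T : ℕ => size i / T) atTop (𝓝 0) :=
    tendsto_const_nhds.div_atTop tendsto_natCast_atTop_atTop
  filter_upwards [hlim.eventually_lt_const hε, eventually_gt_atTop 0] with T hT hT0
  have hpos : (0 : ℝ) < T := Nat.cast_pos.2 hT0
  rw [div_lt_iff₀ hpos] at hT
  rw [div_le_iff₀ hpos]
  linarith [hint T]

/-- The calls of a memoryless rule are i.i.d., so the strong law upgrades the bound on the mean to
the almost sure one. -/
theorem timeAverageAdmissible_applyRule {s : Rule N J Act} (hs : ∀ j, @Measurable _ _ _ ⊤ (s j))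
    (h : ∀ i, E.callProb s i ≤ E.rate i) : E.TimeAverageAdmissible k (applyRule s) := by
  refine ⟨nonAnticipating_applyRule hs, ae_all_iff.2 fun i => ?_⟩
  let ψ : Event N J B → ℝ := fun x => if i ∈ (s x.2.1.1 x.2.2).1 then 1 else 0
  have hψ : Measurable ψ :=
    Measurable.ite (measurable_snd (measurableSet_call hs i)) measurable_const measurable_const
  have hint : Integrable (fun ω : Path N J B => ψ (ω 0)) (E.prob k) :=
    integrable_call (nonAnticipating_applyRule hs) 0 i
  have hlaw := strong_law_ae_real (μ := E.prob k) (fun t ω => ψ (ω t)) hint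
    (fun a b hab => ((E.iIndepFun_eval k).indepFun hab).comp hψ hψ)
    (fun t => (IdentDistrib.mk (measurable_pi_apply t).aemeasurable
      (measurable_pi_apply 0).aemeasurable (by rw [map_eval, map_eval]) :
      IdentDistrib (fun ω : Path N J B => ω t) (fun ω => ω 0) (E.prob k) (E.prob k)).comp hψ)
  have hmean : ∫ ω, ψ (ω 0) ∂(E.prob k) = E.callProb s i := by
    rw [callProb, ← integral_indicator_one (measurableSet_call hs i), ← E.map_snd k 0,
      integral_map (by fun_prop)
        ((measurable_one.indicator (measurableSet_call hs i)).aestronglyMeasurable)]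
    refine integral_congr_ae (Eventually.of_forall fun ω => ?_)
    simp only [Set.indicator_apply, Pi.one_apply, Set.mem_ofPred_eq, market, ψ]
    congr
  filter_upwards [hlaw] with ω hω ε hε
  rw [hmean] at hω
  filter_upwards [hω.eventually_lt_const (show E.callProb s i < E.rate i + ε by linarith [h i]),
    eventually_gt_atTop 0] with T hT hT0
  rw [div_lt_iff₀ (Nat.cast_pos.2 hT0)] at hT
  refine le_trans (le_of_eq ?_) hT.le
  rw [← Finset.sum_boole]
  rfl

end Rates

/-! ### Long-run averages and the performance of a rule. -/

section LongRun

theorem le_longRun {f : ℕ → Path N J B → ℝ} {c C : ℝ}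
    (hC : ∀ t ω, ‖f t ω‖ ≤ C)
    (h : ∀ T : ℕ, c * T ≤ ∑ t ∈ Finset.range T, ∫ ω, f t ω ∂(E.prob k)) :
    c ≤ E.longRun k f := by
  refine le_liminf_of_le ?_ ?_
  -- A real `liminf` is meaningful only for averages that do not escape to infinity; this is the
  -- role of `C`.
  · refine IsBoundedUnder.isCoboundedUnder_ge (isBoundedUnder_of_eventually_le (a := C) ?_)
    filter_upwards [eventually_gt_atTop 0] with T hT
    rw [div_le_iff₀ (Nat.cast_pos.2 hT)]
    calc _ ≤ ∑ t ∈ Finset.range T, C := Finset.sum_le_sum fun t _ => by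
          have := norm_integral_le_of_norm_le_const (μ := E.prob k)
            (Eventually.of_forall fun ω => hC t ω)
          rw [probReal_univ, mul_one] at this
          exact (le_abs_self _).trans this
      _ = C * T := by simp [mul_comm]
  · filter_upwards [eventually_gt_atTop 0] with T hT
    rw [le_div_iff₀ (Nat.cast_pos.2 hT)]
    exact h T

theorem longRun_eq_of_integral_eq {f : ℕ → Path N J B → ℝ} {c : ℝ}
    (h : ∀ t, ∫ ω, f t ω ∂(E.prob k) = c) : E.longRun k f = c := by
  refine Tendsto.liminf_eq (tendsto_const_nhds.congr' ?_)
  filter_upwards [eventually_ne_atTop 0] with T hT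
  simp only [h, Finset.sum_const, Finset.card_range, nsmul_eq_mul]
  exact (mul_div_cancel_left₀ _ (Nat.cast_ne_zero.2 hT)).symm

theorem value_nonneg (E : Exchange N J B Act Alloc) (j : J) (d : Decision N Act) (v : N → B) :
    0 ≤ E.value j d v := by
  obtain ⟨x⟩ := ‹Nonempty Alloc›
  exact (Finset.sum_nonneg fun i _ => E.weight_nonneg j d.2 x v i).trans
    (Finset.le_sup' (fun x : Alloc => ∑ i ∈ d.1, E.weight j d.2 x v i) (Finset.mem_univ x))

theorem exists_value_le (E : Exchange N J B Act Alloc) :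
    ∃ C, ∀ j d v, ‖E.value j d v‖ ≤ C := by
  obtain ⟨C, hC⟩ := (Set.finite_range fun p : J × Decision N Act × (N → B) =>
    ‖E.value p.1 p.2.1 p.2.2‖).bddAbove
  exact ⟨C, fun j d v => hC ⟨(j, d, v), rfl⟩⟩

theorem measurable_comp_decision (hA : NonAnticipating A) (t : ℕ)
    (f : J → Decision N Act → (N → B) → ℝ) :
    Measurable fun ω => f (imp t ω) (A t ω) (bid t ω) := by
  let : MeasurableSpace (Decision N Act) := ⊤
  have : DiscreteMeasurableSpace (Decision N Act) := ⟨fun _ => trivial⟩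
  have h1 : Measurable (fun x : (J × Decision N Act) × (N → B) => f x.1.1 x.1.2 x.2) :=
    Measurable.of_discrete
  exact h1.comp (((measurable_imp t).prodMk (hA.measurable t)).prodMk (measurable_bid t))

theorem exists_weight_le (E : Exchange N J B Act Alloc) :
    ∃ C, ∀ j a x v i, ‖E.weight j a x v i‖ ≤ C := by
  obtain ⟨C, hC⟩ := (Set.finite_range fun p : J × Act × Alloc × (N → B) × N =>
    ‖E.weight p.1 p.2.1 p.2.2.1 p.2.2.2.1 p.2.2.2.2‖).bddAbove
  exact ⟨C, fun j a x v i => hC ⟨(j, a, x, v, i), rfl⟩⟩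

theorem exists_optimal_alloc (E : Exchange N J B Act Alloc) :
    ∃ alloc : J → Decision N Act → (N → B) → Alloc, ∀ j d v,
      E.value j d v = ∑ i ∈ d.1, E.weight j d.2 (alloc j d v) v i := by
  have : ∀ j (d : Decision N Act) v, ∃ x, E.value j d v = ∑ i ∈ d.1, E.weight j d.2 x v i := by
    intro j d v
    obtain ⟨x, -, hx⟩ := Finset.exists_mem_eq_sup' Finset.univ_nonempty
      (fun x : Alloc => ∑ i ∈ d.1, E.weight j d.2 x v i)
    exact ⟨x, hx⟩
  choose alloc h using this
  exact ⟨alloc, h⟩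

theorem perf_nonneg (E : Exchange N J B Act Alloc) (k : Arrival) (A : Policy N J B Act) :
    0 ≤ E.perf k A := by
  obtain ⟨C, hC⟩ := E.exists_value_le
  refine le_longRun (fun t ω => hC _ _ _) fun T => ?_
  rw [zero_mul]
  exact Finset.sum_nonneg fun t _ => integral_nonneg fun ω => E.value_nonneg _ _ _

/-- The performance of a rule. -/
def ruleValue (E : Exchange N J B Act Alloc) (s : Rule N J Act) : ℝ :=
  ∑ p, E.ruleFrequency s p * E.meanValue p

theorem integral_value_applyRule {s : Rule N J Act} (hs : ∀ j, @Measurable _ _ _ ⊤ (s j)) (t : ℕ) :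
    ∫ ω, E.value (imp t ω) (applyRule s t ω) (bid t ω) ∂(E.prob k) = E.ruleValue s := by
  rw [integral_value (nonAnticipating_applyRule hs)]
  simp_rw [prob_applyRule hs]
  rfl

theorem perf_applyRule {s : Rule N J Act} (hs : ∀ j, @Measurable _ _ _ ⊤ (s j)) :
    E.perf k (applyRule s) = E.ruleValue s :=
  longRun_eq_of_integral_eq fun t => integral_value_applyRule hs t

theorem meanValue_nonneg (E : Exchange N J B Act Alloc) (p : J × Decision N Act) :
    0 ≤ E.meanValue p :=
  Finset.sum_nonneg fun _ _ => mul_nonneg ENNReal.toReal_nonneg (E.value_nonneg _ _ _)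

/-- Value is continuous in the frequencies, so the value of `s` is a limit point of the averages for
`A`, and no limit point lies below the `liminf`. -/
theorem perf_le_of_mapClusterPt {s : Rule N J Act} (hA : NonAnticipating A)
    (hc : MapClusterPt (E.ruleFrequency s) atTop (E.decisionFreq k A)) :
    E.perf k A ≤ E.ruleValue s := by
  have h1 : E.perf k A = liminf (fun T => ∑ p, E.decisionFreq k A T p * E.meanValue p) atTop := by
    unfold perf longRun
    congr 1
    funext T
    rw [sum_decisionFreq_mul hA]
    simp_rw [integral_value hA, integral_decision hA]
  have h2 : Continuous fun q : J × Decision N Act → ℝ => ∑ p, q p * E.meanValue p := by fun_prop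
  rw [h1]
  refine MapClusterPt.liminf_le (hc.continuousAt_comp h2.continuousAt)
    (isBoundedUnder_of_eventually_ge (a := 0) (Eventually.of_forall fun T => ?_))
  exact Finset.sum_nonneg fun p _ => mul_nonneg (decisionFreq_mem A T p).1 (E.meanValue_nonneg p)

end LongRun

/-! ### Value retained by the converted policy. -/

section Conversion

variable {s : Rule N J Act} (hs : ∀ j, @Measurable _ _ _ ⊤ (s j))
  (alloc : J → Decision N Act → (N → B) → Alloc) (i : N)

/-- The value received from network `i` when the rule `s` is applied to a market event with a given
seed. -/
def reward (E : Exchange N J B Act Alloc) (s : Rule N J Act)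
    (alloc : J → Decision N Act → (N → B) → Alloc) (i : N)
    (x : (J × (N → B)) × unitInterval) : ℝ :=
  if i ∈ (s x.1.1 x.2).1 then
    E.weight x.1.1 (s x.1.1 x.2).2 (alloc x.1.1 (s x.1.1 x.2) x.1.2) x.1.2 i
  else 0

/-- Expected value received from network `i` at an arrival when the rule `s` is applied. -/
def meanReward (E : Exchange N J B Act Alloc) (s : Rule N J Act)
    (alloc : J → Decision N Act → (N → B) → Alloc) (i : N) : ℝ :=
  ∫ x, E.reward s alloc i x ∂(E.marketLaw.toMeasure.prod (volume : Measure unitInterval))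

theorem reward_nonneg (x : (J × (N → B)) × unitInterval) : 0 ≤ E.reward s alloc i x := by
  unfold reward
  split_ifs
  exacts [E.weight_nonneg _ _ _ _ _, le_rfl]

theorem meanReward_nonneg : 0 ≤ E.meanReward s alloc i :=
  integral_nonneg fun x => reward_nonneg alloc i x

include hs

theorem measurable_reward : Measurable (E.reward s alloc i) := by
  let : MeasurableSpace (Decision N Act) := ⊤
  have : DiscreteMeasurableSpace (Decision N Act) := ⟨fun _ => trivial⟩
  have h1 : Measurable (fun x : (J × (N → B)) × unitInterval => (x.1.1, x.2)) := by fun_prop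
  have h2 : Measurable (fun x : (J × (N → B)) × Decision N Act => if i ∈ x.2.1 then
    E.weight x.1.1 x.2.2 (alloc x.1.1 x.2 x.1.2) x.1.2 i else 0) := Measurable.of_discrete
  exact h2.comp (measurable_fst.prodMk ((measurable_rule hs).comp h1))

theorem integral_reward (t : ℕ) :
    ∫ ω, E.reward s alloc i (market t ω, seed t ω) ∂(E.prob k) = E.meanReward s alloc i := by
  rw [meanReward, ← E.map_snd k t, integral_map (by fun_prop)
    (measurable_reward hs alloc i).aestronglyMeasurable]

theorem networkValue_applyRule :
    E.networkValue k s alloc i (applyRule s) = E.meanReward s alloc i :=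
  longRun_eq_of_integral_eq fun t => integral_reward hs alloc i t

theorem meanReward_eq_zero (h : E.callProb s i = 0) : E.meanReward s alloc i = 0 := by
  refine integral_eq_zero_of_ae ?_
  have h1 : (E.marketLaw.toMeasure.prod (volume : Measure unitInterval))
      {x | i ∈ (s x.1.1 x.2).1} = 0 := (measureReal_eq_zero_iff).1 h
  filter_upwards [measure_eq_zero_iff_ae_notMem.1 h1] with x hx
  exact if_neg hx

theorem meanReward_mul_sum_readyProb_ge {size : N → ℝ} (hsize : 1 < size i)
    (hp : E.callProb s i ≤ E.rate i) (T : ℕ) :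
    (1 - 1 / (size i - 1)) * E.meanReward s alloc i * T ≤
      ∑ t ∈ Finset.range T, E.readyProb k size s i t * E.meanReward s alloc i := by
  rcases eq_or_ne (E.callProb s i) 0 with h0 | h0
  -- A network that is almost never called yields no reward, so the case excluded from the drift
  -- bound is trivial.
  · simp [meanReward_eq_zero hs alloc i h0]
  · rw [← Finset.sum_mul, mul_right_comm]
    exact mul_le_mul_of_nonneg_right (E.sum_readyProb_ge k hs size i hsize hp h0 T)
      (meanReward_nonneg alloc i)

theorem networkValue_throttle_ge {size : N → ℝ} (hsize : 1 < size i)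
    (hp : E.callProb s i ≤ E.rate i) :
    (1 - 1 / (size i - 1)) * E.networkValue k s alloc i (applyRule s) ≤
      E.networkValue k s alloc i (E.throttle size s) := by
  rw [networkValue_applyRule hs]
  obtain ⟨C, hC⟩ := E.exists_weight_le
  refine le_longRun (C := |C|) (fun t ω => ?_) fun T => ?_
  · split_ifs
    · exact (hC _ _ _ _ _).trans (le_abs_self C)
    · simp
  · refine (meanReward_mul_sum_readyProb_ge (k := k) hs alloc i hsize hp T).trans (le_of_eq ?_)
    refine Finset.sum_congr rfl fun t _ => ?_
    rw [meanReward, ← E.integral_ready_mul k hs size i (measurable_reward hs alloc i)]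
    refine integral_congr_ae (Eventually.of_forall fun ω => ?_)
    by_cases h1 : 1 ≤ E.bucket size s ω i t
    · simp only [h1, if_true, one_mul, throttle, Finset.mem_filter, and_true]
      rfl
    · simp [h1, throttle]

/-- An optimal allocation for the unthrottled decision remains available after throttling and still
collects the weights of the ready networks. Each network separately keeps the required fraction of
its share, and the shares add up to `ruleValue`. -/
theorem perf_throttle_ge {size : N → ℝ} {σ : ℝ} (hσ : 1 < σ) (hsize : ∀ i, σ < size i)
    (hp : ∀ i, E.callProb s i ≤ E.rate i) :
    (1 - 1 / (σ - 1)) * E.ruleValue s ≤ E.perf k (E.throttle size s) := by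
  obtain ⟨C, hC⟩ := E.exists_value_le
  obtain ⟨alloc, halloc⟩ := E.exists_optimal_alloc
  obtain ⟨W, hW⟩ := E.exists_weight_le
  have mr := fun i => measurable_reward (E := E) hs alloc i
  have ir : ∀ i t, Integrable (fun ω => E.reward s alloc i (market t ω, seed t ω)) (E.prob k) := by
    intro i t
    refine Integrable.of_bound ((mr i).comp (by fun_prop)).aestronglyMeasurable |W|
      (Eventually.of_forall fun ω => ?_)
    unfold reward
    split_ifs
    · exact (hW _ _ _ _ _).trans (le_abs_self W)
    · simp
  have hrule : E.ruleValue s = ∑ i, E.meanReward s alloc i := by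
    rw [← integral_value_applyRule (k := k) hs 0]
    simp_rw [← integral_reward (k := k) hs alloc _ 0]
    rw [← integral_finsetSum _ fun i _ => ir i 0]
    refine integral_congr_ae (Eventually.of_forall fun ω => ?_)
    simp only [halloc, reward]
    rw [← Finset.sum_filter, Finset.filter_mem_eq_inter, Finset.univ_inter]
    rfl
  have hstep : ∀ t, ∑ i, E.readyProb k size s i t * E.meanReward s alloc i ≤
      ∫ ω, E.value (imp t ω) (E.throttle size s t ω) (bid t ω) ∂(E.prob k) := by
    intro t
    simp_rw [meanReward, ← E.integral_ready_mul k hs size _ (mr _) t]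
    have ii : ∀ i, Integrable (fun ω => (if 1 ≤ E.bucket size s ω i t then (1 : ℝ) else 0) *
        E.reward s alloc i (market t ω, seed t ω)) (E.prob k) := fun i =>
      (ir i t).bdd_mul (c := 1) (Measurable.ite ((E.measurable_bucket hs size i t) measurableSet_Ici)
        measurable_const measurable_const).aestronglyMeasurable
        (Eventually.of_forall fun ω => by split_ifs <;> simp)
    rw [← integral_finsetSum _ fun i _ => ii i]
    have mv := measurable_comp_decision (nonAnticipating_throttle (E := E) hs size) t E.value
    refine integral_mono (integrable_finsetSum _ fun i _ => ii i)
      (Integrable.of_bound mv.aestronglyMeasurable C (Eventually.of_forall fun ω => hC _ _ _))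
      fun ω => ?_
    -- The supremum is tested at the allocation chosen for the decision of `s`, not for the
    -- throttled one.
    refine le_trans (le_of_eq ?_) (Finset.le_sup' (fun x : Alloc =>
      ∑ i ∈ (E.throttle size s t ω).1, E.weight (imp t ω) (E.throttle size s t ω).2 x (bid t ω) i)
      (Finset.mem_univ (alloc (imp t ω) (s (imp t ω) (seed t ω)) (bid t ω))))
    simp only [reward, throttle, ite_mul, one_mul, zero_mul]
    rw [← Finset.sum_filter, ← Finset.sum_filter, Finset.filter_filter]
    refine Finset.sum_congr ?_ fun i _ => rfl
    ext i
    simp only [Finset.mem_filter, Finset.mem_univ, true_and]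
    exact and_comm
  refine le_longRun (fun t ω => hC _ _ _) fun T => ?_
  calc (1 - 1 / (σ - 1)) * E.ruleValue s * T
      = ∑ i, (1 - 1 / (σ - 1)) * E.meanReward s alloc i * T := by
        rw [hrule, Finset.mul_sum, Finset.sum_mul]
    _ ≤ ∑ i, ∑ t ∈ Finset.range T, E.readyProb k size s i t * E.meanReward s alloc i := by
        refine Finset.sum_le_sum fun i _ => le_trans ?_
          (meanReward_mul_sum_readyProb_ge hs alloc i (hσ.trans (hsize i)) (hp i) T)
        refine mul_le_mul_of_nonneg_right (mul_le_mul_of_nonneg_right ?_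
          (meanReward_nonneg alloc i)) (Nat.cast_nonneg _)
        have : 1 / (size i - 1) ≤ 1 / (σ - 1) :=
          one_div_le_one_div_of_le (by linarith) (by linarith [hsize i])
        linarith
    _ = ∑ t ∈ Finset.range T, ∑ i, E.readyProb k size s i t * E.meanReward s alloc i :=
        Finset.sum_comm
    _ ≤ _ := Finset.sum_le_sum fun t _ => hstep t

end Conversion

/-- A token admissible policy is matched by a time-average admissible memoryless policy. -/
theorem TokenAdmissible.exists_rule {size : N → ℝ} (h : E.TokenAdmissible size k A)
    (hsize : ∀ i, 0 ≤ size i) :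
    ∃ s : Rule N J Act, E.TimeAverageAdmissible .uniform (applyRule s : Policy N J B Act) ∧
      E.perf k A ≤ E.perf .uniform (applyRule s) := by
  obtain ⟨s, hs, hc⟩ := exists_rule_mapClusterPt (E := E) k h.1
  refine ⟨s, timeAverageAdmissible_applyRule hs fun i =>
    callProb_le_of_mapClusterPt hs h.1 hc (h.eventually_callRate_le (hsize i)), ?_⟩
  rw [perf_applyRule hs]
  exact perf_le_of_mapClusterPt h.1 hc

end Exchange
end CallOut

end

theorem theorem4 {N J B Act Alloc : Type*} [Fintype N] [DecidableEq N]
    [Fintype J] [MeasurableSpace J] [MeasurableSingletonClass J]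
    [Fintype B] [MeasurableSpace B] [MeasurableSingletonClass B]
    [Fintype Act] [Fintype Alloc] [Nonempty Alloc]
    (E : CallOut.Exchange N J B Act Alloc)
    (size : N → ℝ) (σ : ℝ) (hσ : 1 < σ) (hsize : ∀ i, σ < size i)
    (α : ℝ) (A : CallOut.Policy N J B Act)
    (hA : E.IsApproximate .uniform (E.TimeAverageAdmissible .uniform) α A) :
    -- a memoryless version of the given policy exists
    (∃ s : CallOut.Rule N J Act, E.IsMemorylessVersion A s) ∧
    -- a memoryless policy is a memoryless version of itself
    (∀ s : CallOut.Rule N J Act, (∀ j, @Measurable _ _ _ ⊤ (s j)) →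
      A = CallOut.Exchange.applyRule s → E.IsMemorylessVersion A s) ∧
    -- throttling it converts the policy, for uniform and for Poisson arrivals
    (∀ s : CallOut.Rule N J Act, E.IsMemorylessVersion A s → ∀ k : CallOut.Arrival,
      (∀ (alloc : J → CallOut.Decision N Act → (N → B) → Alloc) (i : N),
        (1 - 1 / (size i - 1)) *
            E.networkValue k s alloc i (CallOut.Exchange.applyRule s) ≤
          E.networkValue k s alloc i (E.throttle size s)) ∧
      E.IsApproximate k (E.TokenAdmissible size k) (α - 1 / (σ - 1)) (E.throttle size s)) := by
  open CallOut CallOut.Exchange in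
  obtain ⟨hadm, hbest⟩ := hA
  refine ⟨?_, ?_, ?_⟩
  · obtain ⟨s, hs, hc⟩ := exists_rule_mapClusterPt (E := E) .uniform hadm.1
    exact ⟨s, hs, hc⟩
  · rintro s hs rfl
    exact isMemorylessVersion_applyRule hs
  · rintro s ⟨hs, hc⟩ k
    have hp : ∀ i, E.callProb s i ≤ E.rate i := fun i =>
      callProb_le_of_mapClusterPt hs hadm.1 hc (hadm.eventually_callRate_le i)
    refine ⟨fun alloc i => networkValue_throttle_ge hs alloc i (hσ.trans (hsize i)) (hp i),
      tokenAdmissible_throttle hs k size, fun A' hA' => ?_⟩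
    obtain ⟨s', hs', hle⟩ := hA'.exists_rule fun i => by linarith [hsize i]
    have h1 := hbest _ hs'
    -- Comparing `A` with itself: if `α > 1`, its performance must vanish.
    have h2 := hbest A hadm
    have h3 : E.perf .uniform A ≤ E.ruleValue s := perf_le_of_mapClusterPt hadm.1 hc
    have h4 := perf_throttle_ge (k := k) hs hσ hsize hp
    have h5 := E.perf_nonneg k (E.throttle size s)
    have h6 := E.perf_nonneg k A'
    have hδ : 0 < 1 / (σ - 1) := one_div_pos.2 (by linarith)
    generalize 1 / (σ - 1) = δ at *
    rcases le_or_gt α δ with hαδ | hαδ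
    · exact (mul_nonpos_of_nonpos_of_nonneg (by linarith) h6).trans h5
    · have h7 : α * E.perf k A' ≤ E.ruleValue s :=
        (mul_le_mul_of_nonneg_left hle (by linarith)).trans (h1.trans h3)
      -- With `P` the performance of `A'` and `V` the value of `s`, the target is `(α - δ) * P ≤ (1
      -- - δ) * V`. If `P ≤ V`, use `α ≤ 1`; if `V ≤ P`, subtract `δ * P ≥ δ * V` from `α * P ≤ V`.
      rcases le_or_gt α 1 with hα | hα
      · rcases le_total (E.perf k A') (E.ruleValue s) with h | h
        · nlinarith
        · nlinarith
      -- For `α > 1` the time-average optimum is zero, hence so is the performance of every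
      -- token-admissible policy.
      · have h8 : E.perf .uniform A ≤ 0 := by nlinarith
        have h9 : E.perf k A' ≤ 0 := by nlinarith
        rw [le_antisymm h9 h6, mul_zero]
        exact h5
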